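/- **Setting.** Let $\mathcal N=\{1,\dots,N\}$ be a set of users and let $L\ge 1$ with $2^L>N$. In every slot a transmitter broadcasts one packet, an element of the field $\mathbb F_q$ with $q=2^L$; user $i$ receives it unaltered or suffers an erasure. The vectors of erasure indicators of the slots are i.i.d. in time and have an arbitrary joint law across users. Let $\epsilon_{\mathcal I}$ be the probability that a packet is erased by all users in $\mathcal I$ (so $\epsilon_\varnothing=1$), and assume $\epsilon_{\{i\}}<1$ for all $i$. After each slot the transmitter and all users learn who received the packet (public feedback). A code of blocklength $n$ with $K_i$ packets for user $i$ has message sets $\mathcal W_i=\mathbb F_q^{K_i}$, a symbol in slot $l$ that depends on the messages and on the outputs of slots $1,\dots,l-1$, and decoders that map the $n$ outputs of user $i$ and the erasure indicators of all users in these slots to an element of $\mathcal W_i$ or to a declared error. A vector $\vec R\ge\vec 0$ is achievable under a class of codes if the class contains, for every $n$, a code of blocklength $n$ with $K_i=\lceil nR_i/L\rceil$ such that the probability that some user does not recover its message, averaged over all messages, tends to $0$. The rate region of the class (in information bits per transmitted symbol) is the closure of the set of achievable rates. **The class $\texttt{CODE1}_{pub}$.** There are queues $Q_{\mathcal S}$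 ($\varnothing\ne\mathcal S\subseteq\mathcal N$) and $Q_{D_i}$ of packets, and integers $K^i_{\mathcal S}$ ($i\in\mathcal S$) and $K_{D_i}$. Initially $Q_{\{i\}}$ consists of the $K_i$ source packets of user $i$, $K^i_{\{i\}}=K_i$, all other queues are empty and all other integers are $0$. The sets $\mathcal S$ are processed in a fixed order with nondecreasing $|\mathcal S|$. While $K^i_{\mathcal S}>0$ for some $i\in\mathcal S$, a combination $s=\sum_{p\in Q_{\mathcal S}}a_s(p)\,p$ is sent. If $\mathcal G$ is the set of users that receive it, then: a copy of $s$ is put into $Q_{D_i}$ for $i\in\mathcal G$; if $\mathcal G=\varnothing$, or $\mathcal G\subseteq\mathcal S$ and $K^i_{\mathcal S}=0$ for all $i\in\mathcal G$, then $s$ is retransmitted in the next slot; for $i\in\mathcal S\cap\mathcal G$ with $K^i_{\mathcal S}>0$, $K^i_{\mathcal S}$ decreases and $K_{D_i}$ increases by $1$; if $\mathcal S\not\subseteq\mathcal G$ and $\mathcal G\not\subseteq\mathcal S$, then $s$ is added to $Q_{\mathcal S\cup\mathcal G}$ and, for $i\in\mathcal S\setminus\mathcal G$ with $K^i_{\mathcal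 S}>0$, $K^i_{\mathcal S}$ decreases and $K^i_{\mathcal S\cup\mathcal G}$ increases by $1$. Let $\vec b^{(i)}_s\in\mathbb F_q^{K_i}$ be the vector of the coefficients of the source packets of user $i$ in $s$. The coefficients $a_s$ of a packet that is not a retransmission are a function, known to all users, of the feedback so far, and are suitable: whenever there are sets $\mathcal B_{D_i}\subseteq\{\vec b^{(i)}_p:p\in Q_{D_i}\}$ and $\mathcal B^{(i)}_{\mathcal I}\subseteq\{\vec b^{(i)}_p:p\in Q_{\mathcal I}\}$ ($i\in\mathcal I$) with $|\mathcal B_{D_i}|=K_{D_i}$ and $|\mathcal B^{(i)}_{\mathcal I}|=K^i_{\mathcal I}$ whose union over $D_i$ and all $\mathcal I\ni i$ with $K^i_{\mathcal I}>0$ is, for each $i$, a basis of $\mathbb F_q^{K_i}$, there are such sets and vectors $\hat{\vec b}_i\in\mathcal B^{(i)}_{\mathcal S}$ for the $i\in\mathcal S$ with $K^i_{\mathcal S}>0$, such that for each of these $i$ the union remains a basis when $\hat{\vec b}_i$ is replaced by $\vec b^{(i)}_s$. User $i$ replays the algorithm and computes the constant $c^{(i)}_s$ of each packet $s$ sent: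 $c^{(i)}_s=0$ for its own source packets, $c^{(i)}_s=\sum_p a_s(p)c^{(i)}_p$ if $s$ is sent from $Q_{\mathcal S}$ with $i\in\mathcal S$, and $c^{(i)}_s=s$ if $i\notin\mathcal S$ and $i$ receives $s$. The code of blocklength $n$ stops after $n$ transmissions. If all $K^i_{\mathcal S}$ are then $0$, user $i$ solves the equations $\sum_u b^{(i)}_s(u)\,x_u=s-c^{(i)}_s$, $s\in Q_{D_i}$, for its source packets; otherwise, or if the solution is not unique, it declares an error. $\texttt{CODE1}_{pub}$ is the class of all these codes, for all $n$, all $(K_i)$, all orders of processing and all suitable generation rules of the coefficients. **Theorem.** For $\mathcal S\subseteq\mathcal N$ and $i\in\mathcal S$ put $$\hat f^i_{\mathcal S}=\sum_{\mathcal H\subseteq\mathcal S\setminus\{i\}}\frac{(-1)^{|\mathcal S|-|\mathcal H|-1}}{1-\epsilon_{\mathcal N\setminus\mathcal H}} .$$ For arbitrary erasure statistics as above, the rate region of $\texttt{CODE1}_{pub}$, in information bits per transmitted symbol, is $$\Big\{\vec R\ge\vec 0:\ \sum_{\varnothing\ne\mathcal S\subseteq\mathcal N}\ \max_{i\in\mathcal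 S}\big(\hat f^i_{\mathcal S}R_i\big)\le L\Big\}.$$ Moreover, every subclass of $\texttt{CODE1}_{pub}$ that contains a code for each $n$ and each $(K_i)$ has the same rate region; in particular, the region does not depend on the order of processing or on the choice of suitable coefficients. -/

import Mathlib

open MeasureTheory ProbabilityTheory Filter Topology

namespace ErasureBC

/-! ### Block codes for the broadcast packet erasure channel with public feedback

The users are the elements of `Fin N`; a packet (input symbol) is an element of the finite field `F`
with `2 ^ L` elements; an output symbol is an element of `Option F`, where `none` is the erasure
symbol. All histories are lists with the most recent slot first. -/

/-- The indicator of erasures (one bit per user, `true` meaning erased) of a vector of outputs. -/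
def erasures {N : ℕ} {F : Type*} (y : Fin N → Option F) : Fin N → Bool :=
  fun i => (y i).isNone

/-- A fixed blocklength code. The message of user `i` is a vector of `packets i` packets. The symbol
sent in a slot is a function `enc` of the messages and of all outputs of the previous slots. After
`len` slots, user `i` applies `dec i` to the list of the pairs (own output symbol, erasure
indicators of all users) of these slots, which is what it knows under public feedback. The value
`none` of a decoder means that an error is declared. -/
structure Code (N : ℕ) (F : Type*) where
  packets : Fin N → ℕ
  len : ℕ
  enc : ((i : Fin N) → Fin (packets i) → F) → List (Fin N → Option F) → F
  dec : (i : Fin N) → List (Option F × (Fin N → Bool)) → Option (Fin (packets i) → F)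

/-- The outputs of the first `l` slots when the message is `w` and user `i` suffers an erasure in
slot `l` iff `z l i = true` (slots are numbered from `0`). -/
def Code.outputs {N : ℕ} {F : Type*} (c : Code N F) (w : (i : Fin N) → Fin (c.packets i) → F)
    (z : ℕ → Fin N → Bool) : ℕ → List (Fin N → Option F)
  | 0 => []
  | l + 1 =>
    (fun i => if z l i then none else some (c.enc w (c.outputs w z l))) :: c.outputs w z l

/-- The reconstruction of its message by user `i`. -/
def Code.decoded {N : ℕ} {F : Type*} (c : Code N F) (w : (i : Fin N) → Fin (c.packets i) → F)
    (z : ℕ → Fin N → Bool) (i : Fin N) : Option (Fin (c.packets i) → F) :=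
  c.dec i ((c.outputs w z c.len).map fun y => (y i, erasures y))

/-- Probability of erroneous decoding by at least one user, for the message `w`. -/
noncomputable def Code.errorProb {N : ℕ} {F Ω : Type*} [MeasurableSpace Ω] (P : Measure Ω)
    (Z : ℕ → Ω → Fin N → Bool) (c : Code N F) (w : (i : Fin N) → Fin (c.packets i) → F) : ℝ :=
  P.real {ω | ∃ i, c.decoded w (fun l => Z l ω) i ≠ some (w i)}

/-- Average of the error probability over all messages. -/
noncomputable def Code.avgError {N : ℕ} {F Ω : Type*} [Fintype F] [MeasurableSpace Ω]
    (P : Measure Ω) (Z : ℕ → Ω → Fin N → Bool) (c : Code N F) : ℝ :=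
  (∑ w : (i : Fin N) → Fin (c.packets i) → F, c.errorProb P Z w) /
    Fintype.card ((i : Fin N) → Fin (c.packets i) → F)

/-- A rate vector `R` (in information bits per transmitted symbol) is achievable under a class of
codes if the class contains codes of all blocklengths `n`, with average error probability tending to
zero, whose message for user `i` consists of `⌈n R i / L⌉` packets of `L` bits, the least number of
packets that carries `n * R i` bits. -/
def AchievableUnder {N : ℕ} {F Ω : Type*} [Fintype F] [MeasurableSpace Ω] (P : Measure Ω)
    (Z : ℕ → Ω → Fin N → Bool) (L : ℕ) (C : Set (Code N F)) (R : Fin N → ℝ) : Prop :=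
  0 ≤ R ∧ ∃ c : ℕ → Code N F,
    (∀ n, c n ∈ C ∧ (c n).len = n ∧ ∀ i, (c n).packets i = ⌈(n : ℝ) * R i / L⌉₊) ∧
    Tendsto (fun n => (c n).avgError P Z) atTop (𝓝 0)

/-- The rate region of a class of codes. -/
def rateRegion {N : ℕ} {F Ω : Type*} [Fintype F] [MeasurableSpace Ω] (P : Measure Ω)
    (Z : ℕ → Ω → Fin N → Bool) (L : ℕ) (C : Set (Code N F)) : Set (Fin N → ℝ) :=
  closure {R | AchievableUnder P Z L C R}

/-! ### The algorithm -/

/-- A packet, written as a linear combination of the source packets of all users; `s i u` is the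
coefficient of the `u`-th source packet of user `i`. In particular `s i` is the coefficient vector
of the packet for user `i`. -/
abbrev Packet {N : ℕ} (F : Type*) (K : Fin N → ℕ) : Type _ := (i : Fin N) → Fin (K i) → F

/-- The content of the packet `s` when the source packets are `w`. -/
def content {N : ℕ} {F : Type*} [Field F] {K : Fin N → ℕ} (s : Packet F K)
    (w : (i : Fin N) → Fin (K i) → F) : F :=
  ∑ i, ∑ u, s i u * w i u

/-- Linear combination of the entries of a list. -/
def comb {F V : Type*} [Field F] [AddCommGroup V] [Module F V] (a : ℕ → F) (q : List V) : V :=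
  ∑ j : Fin q.length, a j • q.get j

/-- The variables of the algorithm: the queues `Q_S` and `Q_{D_i}`, the indices `K^i_S` (`cnt i S`)
and `K_{D_i}`, and, when the last packet has to be retransmitted, the coefficients to be reused. -/
structure State {N : ℕ} (F : Type*) (K : Fin N → ℕ) where
  queue : Finset (Fin N) → List (Packet F K)
  dqueue : Fin N → List (Packet F K)
  cnt : Fin N → Finset (Fin N) → ℕ
  dcnt : Fin N → ℕ
  kept : Option (ℕ → F)

/-- Initialization: `Q_{\{i\}}` holds the source packets of user `i`. -/
def initState {N : ℕ} (F : Type*) [Field F] (K : Fin N → ℕ) : State F K where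
  queue S := (List.finRange N).flatMap fun i =>
    if S = {i} then (List.finRange (K i)).map fun u => Pi.single i (Pi.single u 1) else []
  dqueue _ := []
  cnt i S := if S = {i} then K i else 0
  dcnt _ := 0
  kept := none

/-- The queue in process: the first one, in the order of processing, which still has a positive
index. There is none iff the algorithm has terminated. (Indices are only ever moved from `Q_S` to
queues of a higher level, hence to queues that are processed later, so this is the sequential
processing of the queues, each one until all its indices are zero.) -/
def State.current {N : ℕ} {F : Type*} {K : Fin N → ℕ} (st : State F K)
    (order : List (Finset (Fin N))) : Option (Finset (Fin N)) :=
  order.find? fun S => decide (∃ i ∈ S, 0 < st.cnt i S)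

/-- The users that receive the packet. -/
def receivers {N : ℕ} (z : Fin N → Bool) : Finset (Fin N) :=
  Finset.univ.filter fun i => z i = false

/-- The condition under which a packet sent from `Q_S` and received by exactly the users in `G` is
retransmitted. -/
def State.Retransmit {N : ℕ} {F : Type*} {K : Fin N → ℕ} (st : State F K)
    (S G : Finset (Fin N)) : Prop :=
  G = ∅ ∨ (G ⊆ S ∧ ∀ i ∈ G, st.cnt i S = 0)

instance {N : ℕ} {F : Type*} {K : Fin N → ℕ} (st : State F K) (S G : Finset (Fin N)) :
    Decidable (st.Retransmit S G) :=
  inferInstanceAs (Decidable (_ ∨ _))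

/-- The condition under which a packet sent from `Q_S` and received by exactly the users in `G` is
added to the queue `Q_{S ∪ G}`: it is erased by a user in `S` and received by a user outside `S`. -/
def Moves {N : ℕ} (S G : Finset (Fin N)) : Prop :=
  (∃ i ∈ S, i ∉ G) ∧ ∃ j ∈ G, j ∉ S

instance {N : ℕ} (S G : Finset (Fin N)) : Decidable (Moves S G) :=
  inferInstanceAs (Decidable (_ ∧ _))

/-- The feedback-based actions after the packet with coefficients `a` has been sent from `Q_S` and
received by exactly the users in `G`. -/
def State.act {N : ℕ} {F : Type*} [Field F] {K : Fin N → ℕ} (st : State F K)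
    (S G : Finset (Fin N)) (a : ℕ → F) : State F K where
  queue T :=
    if Moves S G ∧ T = S ∪ G then st.queue T ++ [comb a (st.queue S)] else st.queue T
  dqueue i := if i ∈ G then st.dqueue i ++ [comb a (st.queue S)] else st.dqueue i
  cnt i T :=
    if i ∈ S ∧ 0 < st.cnt i S ∧ (i ∈ G ∨ Moves S G) then
      if T = S then st.cnt i S - 1
      else if i ∉ G ∧ T = S ∪ G then st.cnt i T + 1
      else st.cnt i T
    else st.cnt i T
  dcnt i := if i ∈ S ∧ 0 < st.cnt i S ∧ i ∈ G then st.dcnt i + 1 else st.dcnt i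
  kept := if st.Retransmit S G then some a else none

/-- What is left open by the description of the algorithm for sessions of `K i` packets: the order
in which the queues are processed, and the generation of the coefficients as a function of the
feedback of the previous slots (the `j`-th packet in the queue gets the coefficient
`coeff h j`). Both are known to all users. -/
structure Rule (N : ℕ) (F : Type*) where
  order : List (Finset (Fin N))
  coeff : List (Fin N → Bool) → ℕ → F

/-- The coefficients used for the next packet. -/
def Rule.used {N : ℕ} {F : Type*} {K : Fin N → ℕ} (r : Rule N F) (st : State F K)
    (h : List (Fin N → Bool)) : ℕ → F :=
  st.kept.getD (r.coeff h)

/-- The state of the algorithm as a function of the feedback. -/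
def Rule.run {N : ℕ} {F : Type*} [Field F] (r : Rule N F) (K : Fin N → ℕ) :
    List (Fin N → Bool) → State F K
  | [] => initState F K
  | z :: h =>
    let st := r.run K h
    match st.current r.order with
    | none => st
    | some S => st.act S (receivers z) (r.used st h)

/-! #### Suitable coefficients -/

/-- A set of vectors is a basis of the space. -/
def IsBasisSet (F : Type*) {V : Type*} [Field F] [AddCommGroup V] [Module F V] (B : Set V) : Prop :=
  LinearIndepOn F id B ∧ Submodule.span F B = ⊤

/-- Sets `B_{D_i}` and `B^{(i)}_I` of coefficient vectors. -/
structure BasisSets {N : ℕ} (F : Type*) (K : Fin N → ℕ) where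
  done : (i : Fin N) → Set (Fin (K i) → F)
  inQueue : (i : Fin N) → Finset (Fin N) → Set (Fin (K i) → F)

/-- The union of `B_{D_i}` and of the sets `B^{(i)}_I` with `K^i_I > 0`. -/
def BasisSets.all {N : ℕ} {F : Type*} {K : Fin N → ℕ} (B : BasisSets F K) (st : State F K)
    (i : Fin N) : Set (Fin (K i) → F) :=
  B.done i ∪ ⋃ I ∈ {I : Finset (Fin N) | i ∈ I ∧ 0 < st.cnt i I}, B.inQueue i I

/-- The sets consist of coefficient vectors of packets in the respective queues, have the
cardinalities given by the indices, and together form a basis for every user. -/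
structure BasisSets.Valid {N : ℕ} {F : Type*} [Field F] {K : Fin N → ℕ} (B : BasisSets F K)
    (st : State F K) : Prop where
  done_subset : ∀ i, B.done i ⊆ {b | ∃ p ∈ st.dqueue i, b = p i}
  inQueue_subset : ∀ i I, i ∈ I → B.inQueue i I ⊆ {b | ∃ p ∈ st.queue I, b = p i}
  done_card : ∀ i, (B.done i).ncard = st.dcnt i
  inQueue_card : ∀ i I, i ∈ I → (B.inQueue i I).ncard = st.cnt i I
  basis : ∀ i, IsBasisSet F (B.all st i)

/-- Suitability of the coefficients `a` for a packet to be sent from `Q_S`: provided that valid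
sets exist, there are valid sets, and a vector `b i ∈ B^{(i)}_S` for each `i ∈ S` with `K^i_S > 0`,
such that replacing `b i` by the coefficient vector of the new packet gives again a basis for all
these users. -/
def Suitable {N : ℕ} {F : Type*} [Field F] {K : Fin N → ℕ} (st : State F K)
    (S : Finset (Fin N)) (a : ℕ → F) : Prop :=
  (∃ B : BasisSets F K, B.Valid st) →
    ∃ (B : BasisSets F K) (b : (i : Fin N) → Fin (K i) → F), B.Valid st ∧
      ∀ i ∈ S, 0 < st.cnt i S →
        b i ∈ B.inQueue i S ∧
        IsBasisSet F (insert (comb a (st.queue S) i) (B.all st i \ {b i}))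

/-- The rule processes all nonempty subsets of users, once each and level by level, and always
generates suitable coefficients for packets that are not retransmissions. -/
structure Rule.Admissible {N : ℕ} {F : Type*} [Field F] (r : Rule N F) (K : Fin N → ℕ) :
    Prop where
  nodup : r.order.Nodup
  mem_order : ∀ S, S ∈ r.order ↔ S.Nonempty
  levels : r.order.Pairwise fun S T => S.card ≤ T.card
  suitable : ∀ h S, (r.run K h).current r.order = some S → (r.run K h).kept = none →
    Suitable (r.run K h) S (r.coeff h)

/-! #### Decoding -/

/-- What user `i` computes by replaying the algorithm: the known constants `c^{(i)}_p` of the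
packets `p` in the queues (in the same order as these packets; meaningful for the queues `Q_S` with
`i ∈ S`), and the equations, with left hand sides `b^{(i)}_s` and right hand sides
`s - c^{(i)}_s`, for the packets `s` that it has received. -/
structure Knowledge {N : ℕ} (F : Type*) (K : Fin N → ℕ) (i : Fin N) where
  const : Finset (Fin N) → List F
  eqs : List ((Fin (K i) → F) × F)

/-- The knowledge of user `i` as a function of its outputs and of the public feedback. The constant
of a packet sent from `Q_S` is the combination of the constants of the packets in the queue if
`i ∈ S`, and the received packet itself if `i ∉ S` (such a packet contains no source packet of
`i`). -/
def Rule.knowledge {N : ℕ} {F : Type*} [Field F] (r : Rule N F) (K : Fin N → ℕ) (i : Fin N) :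
    List (Option F × (Fin N → Bool)) → Knowledge F K i
  | [] => { const := fun S => ((initState F K).queue S).map fun _ => 0, eqs := [] }
  | (y, z) :: h =>
    let k := r.knowledge K i h
    let st := r.run K (h.map Prod.snd)
    match st.current r.order with
    | none => k
    | some S =>
      let a := r.used st (h.map Prod.snd)
      let c : F := if i ∈ S then comb a (k.const S) else y.getD 0
      { const := fun T =>
          if Moves S (receivers z) ∧ T = S ∪ receivers z then k.const T ++ [c] else k.const T
        eqs := match y with
          | none => k.eqs
          | some v => k.eqs ++ [(comb a (st.queue S) i, v - c)] }

/-- The decoder of user `i`: if the algorithm has terminated, it solves the system of its equations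
for its own source packets; an error is declared if the algorithm has not terminated or if the
system does not have exactly one solution. -/
noncomputable def Rule.decode {N : ℕ} {F : Type*} [Field F] (r : Rule N F) (K : Fin N → ℕ)
    (i : Fin N) (h : List (Option F × (Fin N → Bool))) : Option (Fin (K i) → F) :=
  open Classical in
  if hx : (r.run K (h.map Prod.snd)).current r.order = none ∧
      ∃! x : Fin (K i) → F, ∀ e ∈ (r.knowledge K i h).eqs, ∑ u, e.1 u * x u = e.2
  then some hx.2.choose else none

/-- The fixed blocklength version of the algorithm: it is stopped after `n` transmissions (dummy
packets are sent if it terminates earlier). -/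
noncomputable def Rule.toCode {N : ℕ} {F : Type*} [Field F] (r : Rule N F) (K : Fin N → ℕ)
    (n : ℕ) : Code N F where
  packets := K
  len := n
  enc w y :=
    let h := y.map erasures
    let st := r.run K h
    match st.current r.order with
    | none => 0
    | some S => content (comb (r.used st h) (st.queue S)) w
  dec i h := r.decode K i h

/-- The class of codes `CODE1_pub`. -/
def CODE1pub (N : ℕ) (F : Type*) [Field F] : Set (Code N F) :=
  {c | ∃ (K : Fin N → ℕ) (n : ℕ) (r : Rule N F), r.Admissible K ∧ c = r.toCode K n}

/-! ### Channel statistics and the region -/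

/-- `ε_I`, the probability that a packet is erased by all users in `I`. -/
noncomputable def eps {N : ℕ} {Ω : Type*} [MeasurableSpace Ω] (P : Measure Ω)
    (Z : ℕ → Ω → Fin N → Bool) (I : Finset (Fin N)) : ℝ :=
  P.real {ω | ∀ i ∈ I, Z 0 ω i = true}

/-- `\hat f^i_S`. -/
noncomputable def fhat {N : ℕ} (ε : Finset (Fin N) → ℝ) (i : Fin N) (S : Finset (Fin N)) : ℝ :=
  ∑ H ∈ (S.erase i).powerset, (-1 : ℝ) ^ (S.card - H.card - 1) / (1 - ε (Finset.univ \ H))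

/-- The rates `R ≥ 0` with `∑_{S ≠ ∅} max_{i ∈ S} \hat f^i_S R_i ≤ L`. -/
def region {N : ℕ} (ε : Finset (Fin N) → ℝ) (L : ℕ) : Set (Fin N → ℝ) :=
  {R | 0 ≤ R ∧
    ∑ S : {S : Finset (Fin N) // S.Nonempty}, S.1.sup' S.2 (fun i => fhat ε i S.1 * R i) ≤ L}

end ErasureBC

/-!
The behaviour of a code in `CODE1pub` is governed by the indices `K^i_S`. Their evolution is a
function of the feedback and of the order of processing alone; the coefficients and the messages do
not enter. The proof therefore splits into an algebraic and a probabilistic part.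

*Algebra.* Suitable coefficients always exist, since the coefficients which do not permit the
required exchange lie in the union of at most `N` proper subspaces, one for each user, and the field
has more than `N` elements (`exists_admissible`). Suitability is what keeps valid basis sets
available: each exchanged vector is replaced by that of the new packet
(`Rule.Admissible.exists_valid_run`). When all indices are zero, all basis vectors of user `i` have
been received by `i`, and its linear system has exactly one solution. Hence the error probability
is, for every message, the probability that the algorithm has not terminated within the blocklength
(`Rule.Admissible.avgError_eq`).

*Probability.* Let `A^i_S` be the number of slots in which `Q_S` is in process and `K^i_S` is
positive. A unit of `K^i_S` performs a Markov chain on the sets `S`, and `fhat ε i S` is the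
expected time that it spends at `S`: the sum of this time over the subsets of `S` that contain `i`
is the mean of a geometric law, and `fhat` is its Möbius inverse. Consequently `fhat` satisfies the
balance equations of the chain (`fhat_balance`). For the actual process, the number of transfers
from `S` to `T` differs from the product of `A^i_S` and the transition probability by a martingale
with bounded increments, which at time `n` is `o(n)` with probability tending to one, uniformly in
the rule (`real_not_typical_le`). Comparing the two systems of balance equations gives
`A^i_S = K_i fhat^i_S + o(n)` at termination, and `≤` at any time (`exists_activity_bound`). Since
the levels are processed in increasing order, `Q_S` is never fed again once its processing has
begun, so its processing time is exactly the maximum of `A^i_S` over `i ∈ S`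
(`Rule.Admissible.exists_tally_active_eq`). Adding these up, the algorithm needs
`∑ S, max_i fhat^i_S K_i + o(n)` slots. With `K_i = ⌈n R_i / L⌉` it terminates in time, with
probability tending to one, if the sum in the definition of the region is less than `L`, and fails
to do so if the sum exceeds `L` (`eventually_terminates_iff`). The boundary is reached by scaling
the rates.
-/

namespace ErasureBC

/-! ### Linear combinations of queues -/

section Comb

variable {F V : Type*} [Field F] [AddCommGroup V] [Module F V]

theorem comb_mem {W : Submodule F V} {q : List V} (hq : ∀ p ∈ q, p ∈ W) (a : ℕ → F) :
    comb a q ∈ W :=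
  Submodule.sum_mem _ fun j _ => W.smul_mem _ (hq _ (List.get_mem q j))

theorem comb_map {V' : Type*} [AddCommGroup V'] [Module F V'] (φ : V →ₗ[F] V') (a : ℕ → F)
    (q : List V) : comb a (q.map φ) = φ (comb a q) := by
  unfold comb
  rw [map_sum]
  refine Fintype.sum_equiv (finCongr (List.length_map _)) _ _ fun j => ?_
  simp

theorem comb_add (a a' : ℕ → F) (q : List V) : comb (a + a') q = comb a q + comb a' q := by
  simp [comb, add_smul, Finset.sum_add_distrib]

theorem comb_smul (t : F) (a : ℕ → F) (q : List V) : comb (t • a) q = t • comb a q := by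
  simp [comb, mul_smul, Finset.smul_sum]

theorem comb_single (q : List V) (j : Fin q.length) :
    comb (Pi.single (j : ℕ) (1 : F)) q = q.get j := by
  unfold comb
  rw [Finset.sum_eq_single j]
  · simp
  · intro k _ hk
    rw [Pi.single_eq_of_ne (fun h => hk (Fin.ext h)), zero_smul]
  · simp

end Comb

/-! ### The effect of one slot on the indices -/

section Step

variable {N : ℕ} {F : Type*} {K : Fin N → ℕ}

theorem State.exists_of_current {st : State F K} {order : List (Finset (Fin N))}
    {S : Finset (Fin N)} (h : st.current order = some S) : ∃ i ∈ S, 0 < st.cnt i S := by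
  simpa using List.find?_some h

theorem State.cnt_eq_zero_of_current_eq_none {st : State F K} {order : List (Finset (Fin N))}
    (horder : ∀ S, S ∈ order ↔ S.Nonempty) (h : st.current order = none)
    {S : Finset (Fin N)} {i : Fin N} (hi : i ∈ S) : st.cnt i S = 0 := by
  have := List.find?_eq_none.1 h S ((horder S).2 ⟨i, hi⟩)
  simp only [decide_eq_true_eq, not_exists, not_and, not_lt, Nat.le_zero] at this
  exact this i hi

theorem State.current_congr {st st' : State F K} (h : ∀ i S, st.cnt i S = st'.cnt i S)
    (order : List (Finset (Fin N))) : st.current order = st'.current order := by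
  simp [State.current, h]

variable [Field F]

/-- For each user, a slot either changes none of its indices, or it delivers a packet to this user,
or it moves one unit from `K^i_S` to `K^i_{S ∪ G}`. -/
theorem State.act_cases (st : State F K) (S G : Finset (Fin N)) (a : ℕ → F) (i : Fin N) :
    (¬(i ∈ S ∧ 0 < st.cnt i S ∧ (i ∈ G ∨ Moves S G)) ∧
      (st.act S G a).cnt i = st.cnt i ∧ (st.act S G a).dcnt i = st.dcnt i) ∨
    (i ∈ S ∧ 0 < st.cnt i S ∧ i ∈ G ∧
      (st.act S G a).cnt i = Function.update (st.cnt i) S (st.cnt i S - 1) ∧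
      (st.act S G a).dcnt i = st.dcnt i + 1) ∨
    (i ∈ S ∧ 0 < st.cnt i S ∧ i ∉ G ∧ Moves S G ∧ S ∪ G ≠ S ∧
      (st.act S G a).cnt i = Function.update (Function.update (st.cnt i) S (st.cnt i S - 1))
        (S ∪ G) (st.cnt i (S ∪ G) + 1) ∧
      (st.act S G a).dcnt i = st.dcnt i) := by
  by_cases hi : i ∈ S ∧ 0 < st.cnt i S ∧ (i ∈ G ∨ Moves S G)
  · right
    obtain ⟨hS, hc, h⟩ := hi
    by_cases hG : i ∈ G
    · left
      refine ⟨hS, hc, hG, ?_, by simp [State.act, hS, hc, hG]⟩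
      funext T
      by_cases hT : T = S
      · simp [State.act, hS, hc, hG, hT]
      · simp [State.act, hG, hT]
    · right
      have hM : Moves S G := h.resolve_left hG
      have hne : S ∪ G ≠ S := by
        obtain ⟨_, j, hj, hjS⟩ := hM
        intro e
        exact hjS (e ▸ Finset.mem_union_right S hj)
      refine ⟨hS, hc, hG, hM, hne, ?_, by simp [State.act, hG]⟩
      funext T
      by_cases hT : T = S
      · subst hT
        simp [State.act, hS, hc, hM, hne.symm]
      · by_cases hT' : T = S ∪ G
        · subst hT'
          simp [State.act, hS, hc, hM, hne, hG]
        · simp [State.act, hT, hT']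
  · left
    refine ⟨hi, ?_, ?_⟩
    · funext T
      simp only [State.act, if_neg hi]
    · have : ¬(i ∈ S ∧ 0 < st.cnt i S ∧ i ∈ G) := fun h => hi ⟨h.1, h.2.1, Or.inl h.2.2⟩
      simp only [State.act, if_neg this]

/-- A retransmission is preceded by a slot that changes neither the indices nor the queues `Q_T`. -/
theorem State.act_cnt_of_retransmit {st : State F K} {S G : Finset (Fin N)}
    (h : st.Retransmit S G) (a : ℕ → F) : (st.act S G a).cnt = st.cnt ∧
      (st.act S G a).dcnt = st.dcnt ∧ (st.act S G a).queue = st.queue := by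
  have hM : ¬Moves S G := by
    rintro ⟨_, j, hj, hjS⟩
    rcases h with rfl | h
    · simp at hj
    · exact hjS (h.1 hj)
  have hG : ∀ i ∈ G, st.cnt i S = 0 := by
    rcases h with rfl | h
    · simp
    · exact h.2
  refine ⟨?_, ?_, ?_⟩
  · funext i
    rcases st.act_cases S G a i with h | h | h
    · exact h.2.1
    · have := hG i h.2.2.1
      omega
    · exact absurd h.2.2.2.1 hM
  · funext i
    rcases st.act_cases S G a i with h | h | h
    · exact h.2.2
    · have := hG i h.2.2.1
      omega
    · exact absurd h.2.2.2.1 hM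
  · funext T
    simp [State.act, hM]

theorem State.queue_subset_act (st : State F K) (S G : Finset (Fin N)) (a : ℕ → F)
    (T : Finset (Fin N)) {p : Packet F K} (hp : p ∈ st.queue T) : p ∈ (st.act S G a).queue T := by
  unfold State.act
  dsimp only
  split_ifs
  · exact List.mem_append_left _ hp
  · exact hp

theorem State.dqueue_subset_act (st : State F K) (S G : Finset (Fin N)) (a : ℕ → F)
    (i : Fin N) {p : Packet F K} (hp : p ∈ st.dqueue i) : p ∈ (st.act S G a).dqueue i := by
  unfold State.act
  dsimp only
  split_ifs
  · exact List.mem_append_left _ hp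
  · exact hp

theorem Rule.run_cons_none {r : Rule N F} {h : List (Fin N → Bool)}
    (hc : (r.run K h).current r.order = none) (z : Fin N → Bool) :
    r.run K (z :: h) = r.run K h := by
  rw [Rule.run]
  simp only [hc]

theorem Rule.run_cons_some {r : Rule N F} {h : List (Fin N → Bool)} {S : Finset (Fin N)}
    (hc : (r.run K h).current r.order = some S) (z : Fin N → Bool) :
    r.run K (z :: h) = (r.run K h).act S (receivers z) (r.used (r.run K h) h) := by
  rw [Rule.run]
  simp only [hc]

/-- Every unit of `K i` is always accounted for by exactly one index of user `i`. -/
theorem Rule.sum_indices (r : Rule N F) (h : List (Fin N → Bool)) (i : Fin N) :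
    (r.run K h).dcnt i + ∑ I with i ∈ I, (r.run K h).cnt i I = K i := by
  induction h with
  | nil =>
    simp only [Rule.run, initState, zero_add]
    rw [Finset.sum_eq_single {i}] <;> simp +contextual
  | cons z h ih =>
    cases hc : (r.run K h).current r.order with
    | none => rwa [Rule.run_cons_none hc]
    | some S =>
      rw [Rule.run_cons_some hc]
      set st := r.run K h
      set G := receivers z
      have key : ∀ (f : Finset (Fin N) → ℕ) (T : Finset (Fin N)) (m : ℕ), i ∈ T →
          ∑ I with i ∈ I, Function.update f T m I + f T = ∑ I with i ∈ I, f I + m := by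
        intro f T m hT
        have hT' : T ∈ Finset.univ.filter fun I => i ∈ I := by simpa using hT
        rw [Finset.sum_update_of_mem hT', Finset.sdiff_singleton_eq_erase,
          ← Finset.add_sum_erase _ f hT']
        ring
      rcases st.act_cases S G (r.used st h) i with ⟨-, h1, h2⟩ | ⟨hS, hp, hG, h1, h2⟩ |
        ⟨hS, hp, hG, hM, hne, h1, h2⟩
      · rw [h1, h2, ih]
      · rw [h1, h2]
        have := key (st.cnt i) S (st.cnt i S - 1) hS
        omega
      · rw [h1, h2]
        have e1 := key (st.cnt i) S (st.cnt i S - 1) hS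
        have e2 := key (Function.update (st.cnt i) S (st.cnt i S - 1)) (S ∪ G)
          (st.cnt i (S ∪ G) + 1) (Finset.mem_union_left _ hS)
        rw [Function.update_of_ne hne] at e2
        omega

end Step

/-! ### Suitable coefficients keep the basis sets alive -/

section Basis

variable {F V : Type*} [Field F] [AddCommGroup V] [Module F V]

theorem IsBasisSet.exchange {B : Set V} (hB : IsBasisSet F B) {b s : V} (hb : b ∈ B)
    (hs : s ∉ Submodule.span F (B \ {b})) : IsBasisSet F (insert s (B \ {b})) := by
  refine ⟨(hB.1.mono Set.sdiff_subset).id_insert hs, ?_⟩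
  have hsB : s ∈ Submodule.span F (insert b (B \ {b})) := by
    rw [Set.insert_sdiff_singleton, Set.insert_eq_of_mem hb, hB.2]
    trivial
  have hbs := mem_span_insert_exchange hsB hs
  rw [eq_top_iff, ← hB.2, Submodule.span_le]
  intro x hx
  by_cases hxb : x = b
  · exact hxb ▸ hbs
  · exact Submodule.subset_span (Set.mem_insert_of_mem _ ⟨hx, hxb⟩)

/-- If finitely many sets span a space, and bounds on their cardinalities add up to its dimension,
then the bounds are attained and the union of the sets is linearly independent. -/
theorem ncard_eq_and_linearIndepOn_of_span [Finite V] {α : Type*} (J : Finset α) {D : Set V}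
    {Q : α → Set V} {d : ℕ} {m : α → ℕ} (hD : D.ncard ≤ d) (hQ : ∀ I ∈ J, (Q I).ncard ≤ m I)
    (hsum : d + ∑ I ∈ J, m I = Module.finrank F V)
    (hspan : Submodule.span F (D ∪ ⋃ I ∈ J, Q I) = ⊤) :
    D.ncard = d ∧ (∀ I ∈ J, (Q I).ncard = m I) ∧ LinearIndepOn F id (D ∪ ⋃ I ∈ J, Q I) := by
  classical
  have : Module.Finite F V := Module.Finite.of_finite
  have := Fintype.ofFinite V
  set U := D ∪ ⋃ I ∈ J, Q I with hU
  have h1 : U.ncard ≤ D.ncard + ∑ I ∈ J, (Q I).ncard :=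
    (Set.ncard_union_le _ _).trans (Nat.add_le_add_left (Finset.set_ncard_biUnion_le J Q) _)
  have h2 : Module.finrank F V ≤ U.ncard := by
    have := finrank_span_le_card (R := F) U
    rw [hspan, finrank_top] at this
    rwa [Set.ncard_eq_toFinset_card' U]
  have h3 : ∑ I ∈ J, (Q I).ncard ≤ ∑ I ∈ J, m I := Finset.sum_le_sum hQ
  refine ⟨by omega, ?_, ?_⟩
  · exact (Finset.sum_eq_sum_iff_of_le hQ).1 (by omega)
  · refine linearIndependent_of_top_le_span_of_card_eq_finrank ?_ ?_
    · simp [hspan]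
    · rw [← Nat.card_eq_fintype_card, Nat.card_coe_set_eq]
      omega

end Basis

section Valid

variable {N : ℕ} {F : Type*} [Field F] {K : Fin N → ℕ}

/-- The indices bound the cardinalities of the basis sets, and add up to the dimension. Hence it
suffices that the sets are small enough and span. -/
theorem BasisSets.valid_of_span [Finite F] {st : State F K}
    (hsum : ∀ i, st.dcnt i + ∑ I with i ∈ I, st.cnt i I = K i) {B : BasisSets F K}
    (hd : ∀ i, B.done i ⊆ {b | ∃ p ∈ st.dqueue i, b = p i})
    (hq : ∀ i I, i ∈ I → B.inQueue i I ⊆ {b | ∃ p ∈ st.queue I, b = p i})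
    (hdc : ∀ i, (B.done i).ncard ≤ st.dcnt i)
    (hqc : ∀ i I, i ∈ I → (B.inQueue i I).ncard ≤ st.cnt i I)
    (hspan : ∀ i, Submodule.span F (B.done i ∪ ⋃ I ∈ {I | i ∈ I}, B.inQueue i I) = ⊤) :
    B.Valid st := by
  have key : ∀ i, (B.done i).ncard = st.dcnt i ∧
      (∀ I ∈ Finset.univ.filter (fun I => i ∈ I), (B.inQueue i I).ncard = st.cnt i I) ∧
      LinearIndepOn F id (B.done i ∪ ⋃ I ∈ Finset.univ.filter (fun I => i ∈ I), B.inQueue i I) := by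
    intro i
    refine ncard_eq_and_linearIndepOn_of_span _ (hdc i) ?_ ?_ ?_
    · intro I hI
      exact hqc i I (by simpa using hI)
    · rw [hsum i, Module.finrank_fin_fun]
    · simpa using hspan i
  have hall : ∀ i, B.all st i = B.done i ∪ ⋃ I ∈ {I | i ∈ I}, B.inQueue i I := by
    intro i
    ext x
    simp only [BasisSets.all, Set.mem_union, Set.mem_iUnion, Set.mem_ofPred_eq, exists_prop]
    refine or_congr_right (exists_congr fun I => ⟨fun h => ⟨h.1.1, h.2⟩, fun h => ⟨⟨h.1, ?_⟩, h.2⟩⟩)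
    rw [← (key i).2.1 I (by simpa using h.1), Set.ncard_pos]
    exact ⟨x, h.2⟩
  refine ⟨hd, hq, fun i => (key i).1, fun i I hI => (key i).2.1 I (by simpa using hI), fun i => ?_⟩
  rw [hall]
  exact ⟨by simpa using (key i).2.2, hspan i⟩

theorem BasisSets.Valid.subset_all {st : State F K} {B : BasisSets F K} (hB : B.Valid st)
    {i : Fin N} [Finite F] {I : Finset (Fin N)} (hI : i ∈ I) :
    B.inQueue i I ⊆ B.all st i := by
  intro x hx
  refine Or.inr (Set.mem_biUnion (x := I) ⟨hI, ?_⟩ hx)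
  rw [← hB.inQueue_card i I hI, Set.ncard_pos]
  exact ⟨x, hx⟩

theorem exists_valid_initState [Finite F] : ∃ B : BasisSets F K, B.Valid (initState F K) := by
  refine ⟨⟨fun _ => ∅, fun i I => if I = {i} then Set.range (fun u => Pi.single u 1) else ∅⟩,
    BasisSets.valid_of_span ?_ ?_ ?_ ?_ ?_ ?_⟩
  · intro i
    exact Rule.sum_indices ⟨[], fun _ _ => 0⟩ [] i
  · simp
  · intro i I _
    dsimp only
    split_ifs with h
    · rintro _ ⟨u, rfl⟩
      refine ⟨Pi.single i (Pi.single u 1), ?_, by simp⟩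
      simp only [initState, List.mem_flatMap, List.mem_finRange, true_and]
      exact ⟨i, by simp [h]⟩
    · simp
  · simp
  · intro i I _
    simp only [initState]
    split_ifs with h
    · rw [← Nat.card_coe_set_eq]
      exact (Finite.card_range_le _).trans (by simp)
    · simp
  · intro i
    rw [eq_top_iff, ← (Pi.basisFun F (Fin (K i))).span_eq, Submodule.span_le]
    rintro _ ⟨u, rfl⟩
    refine Submodule.subset_span (Or.inr (Set.mem_biUnion (x := {i}) (by simp) ?_))
    simp only [if_true]
    exact ⟨u, by simp⟩

/-- There are valid basis sets in which, for every user with a positive index at the queue in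
process, some vector can be exchanged for the coefficient vector of the new packet. -/
def Exchangeable (st : State F K) (S : Finset (Fin N)) (a : ℕ → F) : Prop :=
  ∃ (B : BasisSets F K) (b : (i : Fin N) → Fin (K i) → F), B.Valid st ∧
    ∀ i ∈ S, 0 < st.cnt i S →
      b i ∈ B.inQueue i S ∧ IsBasisSet F (insert (comb a (st.queue S) i) (B.all st i \ {b i}))

theorem BasisSets.Valid.congr {st st' : State F K} {B : BasisSets F K} (hB : B.Valid st)
    (hc : st'.cnt = st.cnt) (hd : st'.dcnt = st.dcnt) (hq : st'.queue = st.queue)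
    (hdq : ∀ i, ∀ p ∈ st.dqueue i, p ∈ st'.dqueue i) : B.Valid st' := by
  refine ⟨fun i x hx => ?_, ?_, ?_, ?_, ?_⟩
  · obtain ⟨p, hp, rfl⟩ := hB.done_subset i hx
    exact ⟨p, hdq i p hp, rfl⟩
  · rw [hq]
    exact hB.inQueue_subset
  · rw [hd]
    exact hB.done_card
  · rw [hc]
    exact hB.inQueue_card
  · have : ∀ i, B.all st' i = B.all st i := fun i => by simp [BasisSets.all, hc]
    simpa [this] using hB.basis

/-- The exchange: after a slot, the coefficient vector of the packet takes the place of the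
exchanged vector, in `B_{D_i}` for a user which has received it and in the set of the queue
`Q_{S ∪ G}` for a user which has not. -/
theorem Exchangeable.exists_valid_act [Finite F] {st : State F K} {S : Finset (Fin N)}
    {a : ℕ → F} (h : Exchangeable st S a) (G : Finset (Fin N))
    (hsum : ∀ i, (st.act S G a).dcnt i + ∑ I with i ∈ I, (st.act S G a).cnt i I = K i) :
    ∃ B : BasisSets F K, B.Valid (st.act S G a) := by
  obtain ⟨B, b, hB, hb⟩ := h
  set st' := st.act S G a with hst'
  set s := comb a (st.queue S) with hs
  suffices H : ∀ i, ∃ (D : Set (Fin (K i) → F)) (Q : Finset (Fin N) → Set (Fin (K i) → F)),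
      D ⊆ {b | ∃ p ∈ st'.dqueue i, b = p i} ∧
      (∀ I, i ∈ I → Q I ⊆ {b | ∃ p ∈ st'.queue I, b = p i}) ∧
      D.ncard ≤ st'.dcnt i ∧ (∀ I, i ∈ I → (Q I).ncard ≤ st'.cnt i I) ∧
      Submodule.span F (D ∪ ⋃ I ∈ {I | i ∈ I}, Q I) = ⊤ by
    choose D Q h1 h2 h3 h4 h5 using H
    exact ⟨⟨D, Q⟩, BasisSets.valid_of_span hsum h1 h2 h3 h4 h5⟩
  intro i
  have hd : B.done i ⊆ {b | ∃ p ∈ st'.dqueue i, b = p i} := fun x hx => by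
    obtain ⟨p, hp, rfl⟩ := hB.done_subset i hx
    exact ⟨p, st.dqueue_subset_act S G a i hp, rfl⟩
  have hq : ∀ I, i ∈ I → B.inQueue i I ⊆ {b | ∃ p ∈ st'.queue I, b = p i} := fun I hI x hx => by
    obtain ⟨p, hp, rfl⟩ := hB.inQueue_subset i I hI hx
    exact ⟨p, st.queue_subset_act S G a I hp, rfl⟩
  have hall : B.all st i ⊆ B.done i ∪ ⋃ I ∈ {I | i ∈ I}, B.inQueue i I := by
    refine Set.union_subset_union_right _ ?_
    exact Set.biUnion_subset_biUnion_left fun I hI => hI.1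
  have hrm : (B.inQueue i S).ncard = st.cnt i S → b i ∈ B.inQueue i S →
      (B.inQueue i S \ {b i}).ncard = st.cnt i S - 1 := fun h1 h2 => by
    rw [Set.ncard_sdiff_singleton_of_mem h2, h1]
  rcases st.act_cases S G a i with ⟨-, h1, h2⟩ | ⟨hS, hp, hG, h1, h2⟩ |
      ⟨hS, hp, hG, hM, hne, h1, h2⟩
  · refine ⟨B.done i, B.inQueue i, hd, hq, ?_, ?_, ?_⟩
    · rw [h2, hB.done_card]
    · intro I hI
      rw [h1, hB.inQueue_card i I hI]
    · rw [eq_top_iff, ← (hB.basis i).2]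
      exact Submodule.span_mono hall
  · obtain ⟨hbi, hbas⟩ := hb i hS hp
    refine ⟨insert (s i) (B.done i), Function.update (B.inQueue i) S (B.inQueue i S \ {b i}),
      ?_, ?_, ?_, ?_, ?_⟩
    · refine Set.insert_subset ⟨s, ?_, rfl⟩ hd
      simp [hst', State.act, hG, hs]
    · intro I hI
      by_cases hIS : I = S
      · subst hIS
        rw [Function.update_self]
        exact Set.sdiff_subset.trans (hq _ hI)
      · rw [Function.update_of_ne hIS]
        exact hq I hI
    · rw [h2, ← hB.done_card]
      exact Set.ncard_insert_le _ _
    · intro I hI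
      rw [h1]
      by_cases hIS : I = S
      · subst hIS
        rw [Function.update_self, Function.update_self, hrm (hB.inQueue_card i _ hI) hbi]
      · rw [Function.update_of_ne hIS, Function.update_of_ne hIS, hB.inQueue_card i I hI]
    · rw [eq_top_iff, ← hbas.2]
      refine Submodule.span_mono (Set.insert_subset (Or.inl (Set.mem_insert _ _)) ?_)
      rintro x ⟨hx, hxb⟩
      rcases hall hx with hx | hx
      · exact Or.inl (Set.mem_insert_of_mem _ hx)
      · obtain ⟨I, hI, hx⟩ := Set.mem_iUnion₂.1 hx
        refine Or.inr (Set.mem_biUnion hI ?_)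
        by_cases hIS : I = S
        · subst hIS
          rw [Function.update_self]
          exact ⟨hx, hxb⟩
        · rwa [Function.update_of_ne hIS]
  · obtain ⟨hbi, hbas⟩ := hb i hS hp
    refine ⟨B.done i, Function.update (Function.update (B.inQueue i) S (B.inQueue i S \ {b i}))
      (S ∪ G) (insert (s i) (B.inQueue i (S ∪ G))), hd, ?_, ?_, ?_, ?_⟩
    · intro I hI
      by_cases hIG : I = S ∪ G
      · subst hIG
        rw [Function.update_self]
        refine Set.insert_subset ⟨s, ?_, rfl⟩ (hq _ hI)
        simp [hst', State.act, hM, hs]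
      rw [Function.update_of_ne hIG]
      by_cases hIS : I = S
      · subst hIS
        rw [Function.update_self]
        exact Set.sdiff_subset.trans (hq _ hI)
      · rw [Function.update_of_ne hIS]
        exact hq I hI
    · rw [h2, ← hB.done_card]
    · intro I hI
      rw [h1]
      by_cases hIG : I = S ∪ G
      · subst hIG
        rw [Function.update_self, Function.update_self, ← hB.inQueue_card i _ hI]
        exact Set.ncard_insert_le _ _
      rw [Function.update_of_ne hIG, Function.update_of_ne hIG]
      by_cases hIS : I = S
      · subst hIS
        rw [Function.update_self, Function.update_self, hrm (hB.inQueue_card i _ hI) hbi]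
      · rw [Function.update_of_ne hIS, Function.update_of_ne hIS, hB.inQueue_card i I hI]
    · rw [eq_top_iff, ← hbas.2]
      refine Submodule.span_mono (Set.insert_subset (Or.inr ?_) ?_)
      · refine Set.mem_biUnion (x := S ∪ G) (Finset.mem_union_left _ hS) ?_
        rw [Function.update_self]
        exact Set.mem_insert _ _
      rintro x ⟨hx, hxb⟩
      rcases hall hx with hx | hx
      · exact Or.inl hx
      · obtain ⟨I, hI, hx⟩ := Set.mem_iUnion₂.1 hx
        refine Or.inr (Set.mem_biUnion hI ?_)
        by_cases hIG : I = S ∪ G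
        · subst hIG
          rw [Function.update_self]
          exact Set.mem_insert_of_mem _ hx
        rw [Function.update_of_ne hIG]
        by_cases hIS : I = S
        · subst hIS
          rw [Function.update_self]
          exact ⟨hx, hxb⟩
        · rwa [Function.update_of_ne hIS]

/-- Valid basis sets exist at all times; and while a packet is to be retransmitted, its coefficients
remain exchangeable. -/
theorem Rule.Admissible.exists_valid_run [Finite F] {r : Rule N F} (hr : r.Admissible K)
    (h : List (Fin N → Bool)) : (∃ B : BasisSets F K, B.Valid (r.run K h)) ∧
      ∀ a, (r.run K h).kept = some a →
        ∃ S, (r.run K h).current r.order = some S ∧ Exchangeable (r.run K h) S a := by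
  induction h with
  | nil => exact ⟨exists_valid_initState, by simp [Rule.run, initState]⟩
  | cons z h ih =>
    cases hc : (r.run K h).current r.order with
    | none =>
      rw [Rule.run_cons_none hc]
      exact ih
    | some S =>
      have hsum := r.sum_indices (K := K) (z :: h)
      rw [Rule.run_cons_some hc] at hsum ⊢
      have hex : Exchangeable (r.run K h) S (r.used (r.run K h) h) := by
        cases hk : (r.run K h).kept with
        | none =>
          rw [Rule.used, hk]
          exact hr.suitable h S hc hk ih.1
        | some a =>
          obtain ⟨S', hS', ha⟩ := ih.2 a hk
          rw [hc, Option.some_inj] at hS'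
          subst hS'
          rwa [Rule.used, hk]
      refine ⟨hex.exists_valid_act _ hsum, fun a ha => ?_⟩
      by_cases hR : (r.run K h).Retransmit S (receivers z)
      · have ha' : a = r.used (r.run K h) h := by simpa [State.act, hR, eq_comm] using ha
        subst ha'
        set st := r.run K h
        obtain ⟨h1, h2, h3⟩ := State.act_cnt_of_retransmit hR (r.used st h)
        refine ⟨S, ?_, ?_⟩
        · rw [← hc]
          exact State.current_congr (by simp [h1]) _
        · obtain ⟨B, b, hB, hb⟩ := hex
          refine ⟨B, b, hB.congr h1 h2 h3 fun i p => st.dqueue_subset_act _ _ _ i, ?_⟩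
          intro i hi hp
          rw [h1] at hp
          have : B.all (st.act S (receivers z) (r.used st h)) i = B.all st i := by
            simp [BasisSets.all, h1]
          rw [h3, this]
          exact hb i hi hp
      · simp [State.act, hR] at ha

/-- Once the algorithm has terminated, the coefficient vectors of the packets received by user `i`
span. -/
theorem Rule.Admissible.span_dqueue_eq_top [Finite F] {r : Rule N F} (hr : r.Admissible K)
    {h : List (Fin N → Bool)} (hc : (r.run K h).current r.order = none) (i : Fin N) :
    Submodule.span F {b | ∃ p ∈ (r.run K h).dqueue i, b = p i} = ⊤ := by
  obtain ⟨B, hB⟩ := (hr.exists_valid_run h).1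
  rw [eq_top_iff, ← (hB.basis i).2]
  refine Submodule.span_mono (Set.union_subset (hB.done_subset i) ?_)
  refine Set.iUnion₂_subset fun I hI => ?_
  have := State.cnt_eq_zero_of_current_eq_none hr.mem_order hc hI.1
  exact absurd hI.2 (by omega)

end Valid

/-! ### Existence of suitable coefficients -/

/-- A vector space is not the union of fewer proper subspaces than its field has elements. -/
theorem exists_forall_notMem_submodule {F E ι : Type*} [Field F] [Fintype F] [AddCommGroup E]
    [Module F E] (s : Finset ι) (W : ι → Submodule F E) (hW : ∀ i ∈ s, ∃ x, x ∉ W i)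
    (hs : s.card < Fintype.card F) : ∃ x, ∀ i ∈ s, x ∉ W i := by
  classical
  induction s using Finset.induction_on with
  | empty => exact ⟨0, by simp⟩
  | insert j s hj ih =>
    obtain ⟨x, hx⟩ := ih (fun i hi => hW i (Finset.mem_insert_of_mem hi))
      (lt_of_le_of_lt (Finset.card_le_card (Finset.subset_insert _ _)) hs)
    obtain ⟨y, hy⟩ := hW j (Finset.mem_insert_self _ _)
    by_contra! hcon
    -- On the line through `x` with direction `y`, each subspace contains at most one point.
    choose g hg hgW using fun t : F => hcon (x + t • y)
    obtain ⟨t, -, t', -, hne, heq⟩ := Finset.exists_ne_map_eq_of_card_lt_of_maps_to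
      (s := Finset.univ) (t := insert j s) (by simpa using hs) (f := g) (fun t _ => hg t)
    have h1 := hgW t
    have h2 := hgW t'
    rw [← heq] at h2
    have hyW : y ∈ W (g t) := by
      have := (W (g t)).sub_mem h1 h2
      rw [add_sub_add_left_eq_sub, ← sub_smul] at this
      exact ((W (g t)).smul_mem_iff (sub_ne_zero.2 hne)).1 this
    have hxW : x ∈ W (g t) := by
      simpa using (W (g t)).sub_mem h1 ((W (g t)).smul_mem t hyW)
    rcases Finset.mem_insert.1 (hg t) with h | h
    · exact hy (h ▸ hyW)
    · exact hx _ h hxW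

section Existence

variable {N : ℕ} {F : Type*} [Field F] {K : Fin N → ℕ}

/-- For each user with a positive index, fix a basis vector to be exchanged. The coefficients for
which this exchange fails form a proper subspace, and there are at most `N` of these. -/
theorem exists_suitable [Fintype F] (hN : N < Fintype.card F) (st : State F K)
    (S : Finset (Fin N)) : ∃ a : ℕ → F, Suitable st S a := by
  by_cases hB : ∃ B : BasisSets F K, B.Valid st
  swap
  · exact ⟨0, fun h => absurd h hB⟩
  obtain ⟨B, hB⟩ := hB
  have hne : ∀ i, ∃ x : Fin (K i) → F, i ∈ S → 0 < st.cnt i S → x ∈ B.inQueue i S := by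
    intro i
    by_cases h : i ∈ S ∧ 0 < st.cnt i S
    · rw [← hB.inQueue_card i S h.1, Set.ncard_pos] at h
      obtain ⟨x, hx⟩ := h.2
      exact ⟨x, fun _ _ => hx⟩
    · exact ⟨0, fun h1 h2 => absurd ⟨h1, h2⟩ h⟩
  choose b hb using hne
  let ev (i : Fin N) : (ℕ → F) →ₗ[F] (Fin (K i) → F) :=
    { toFun := fun a => comb a (st.queue S) i
      map_add' := fun a a' => by rw [comb_add, Pi.add_apply]
      map_smul' := fun t a => by rw [comb_smul]; rfl }
  have hW : ∀ i ∈ S.filter fun i => 0 < st.cnt i S,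
      ∃ a, a ∉ (Submodule.span F (B.all st i \ {b i})).comap (ev i) := by
    intro i hi
    obtain ⟨hi, hp⟩ := Finset.mem_filter.1 hi
    obtain ⟨p, hp', hbp⟩ := hB.inQueue_subset i S hi (hb i hi hp)
    obtain ⟨j, rfl⟩ := List.get_of_mem hp'
    refine ⟨Pi.single (j : ℕ) 1, ?_⟩
    change comb (Pi.single (j : ℕ) (1 : F)) (st.queue S) i ∉ Submodule.span F (B.all st i \ {b i})
    rw [comb_single, ← hbp]
    have hli := linearIndepOn_iff_notMem_span.1 (hB.basis i).1 (b i)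
      (hB.subset_all hi (hb i hi hp))
    simpa using hli
  obtain ⟨a, ha⟩ := exists_forall_notMem_submodule _ _ hW
    (lt_of_le_of_lt (Finset.card_le_univ _) (by simpa using hN))
  refine ⟨a, fun _ => ⟨B, b, hB, fun i hi hp => ⟨hb i hi hp, ?_⟩⟩⟩
  exact (hB.basis i).exchange (hB.subset_all hi (hb i hi hp))
    (ha i (Finset.mem_filter.2 ⟨hi, hp⟩))

/-- The state of the algorithm when, after every feedback history, suitable coefficients for the
current state are chosen. -/
noncomputable def greedyRun [Fintype F] (hN : N < Fintype.card F) (K : Fin N → ℕ)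
    (order : List (Finset (Fin N))) : List (Fin N → Bool) → State F K
  | [] => initState F K
  | z :: h =>
    match (greedyRun hN K order h).current order with
    | none => greedyRun hN K order h
    | some S => (greedyRun hN K order h).act S (receivers z)
        ((greedyRun hN K order h).kept.getD
          (exists_suitable hN (greedyRun hN K order h) S).choose)

/-- The coefficients chosen in `greedyRun`, as a function of the feedback. -/
noncomputable def greedyCoeff [Fintype F] (hN : N < Fintype.card F) (K : Fin N → ℕ)
    (order : List (Finset (Fin N))) (h : List (Fin N → Bool)) : ℕ → F :=
  match (greedyRun hN K order h).current order with
  | none => 0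
  | some S => (exists_suitable hN (greedyRun hN K order h) S).choose

theorem run_greedyCoeff [Fintype F] (hN : N < Fintype.card F) (K : Fin N → ℕ)
    (order : List (Finset (Fin N))) (h : List (Fin N → Bool)) :
    (Rule.mk order (greedyCoeff hN K order)).run K h = greedyRun hN K order h := by
  induction h with
  | nil => rfl
  | cons z h ih =>
    cases hc : (greedyRun hN K order h).current order with
    | none =>
      rw [Rule.run_cons_none (by rw [ih]; exact hc), ih, greedyRun]
      simp only [hc]
    | some S =>
      rw [Rule.run_cons_some (by rw [ih]; exact hc), ih, greedyRun]
      simp only [hc, Rule.used, greedyCoeff]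

variable (N) in
/-- The nonempty sets of users can be ordered by cardinality. -/
theorem exists_order : ∃ order : List (Finset (Fin N)), order.Nodup ∧
    (∀ S, S ∈ order ↔ S.Nonempty) ∧ order.Pairwise fun S T => S.card ≤ T.card := by
  let l := (Finset.univ.filter fun S : Finset (Fin N) => S.Nonempty).toList
  refine ⟨l.insertionSort fun S T => S.card ≤ T.card, ?_, fun S => ?_, ?_⟩
  · exact (List.perm_insertionSort _ l).nodup_iff.2 (Finset.nodup_toList _)
  · rw [(List.perm_insertionSort _ l).mem_iff]
    simp [l]
  · have : Std.Total fun S T : Finset (Fin N) => S.card ≤ T.card := ⟨fun S T => le_total _ _⟩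
    have : IsTrans (Finset (Fin N)) fun S T => S.card ≤ T.card := ⟨fun _ _ _ => le_trans⟩
    exact List.pairwise_insertionSort _ l

theorem exists_admissible [Fintype F] (hN : N < Fintype.card F) (K : Fin N → ℕ) :
    ∃ r : Rule N F, r.Admissible K := by
  obtain ⟨order, h1, h2, h3⟩ := exists_order N
  refine ⟨⟨order, greedyCoeff hN K order⟩, h1, h2, h3, fun h S hc _ => ?_⟩
  rw [run_greedyCoeff] at hc ⊢
  simp only [greedyCoeff, hc]
  exact (exists_suitable hN (greedyRun hN K order h) S).choose_spec

end Existence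

/-! ### Decoding succeeds exactly when the algorithm has terminated -/

/-- The feedback of the first `l` slots, the most recent slot first. -/
def feedback {N : ℕ} (z : ℕ → Fin N → Bool) : ℕ → List (Fin N → Bool)
  | 0 => []
  | l + 1 => z l :: feedback z l

theorem Code.outputs_map_erasures {N : ℕ} {F : Type*} (c : Code N F)
    (w : (i : Fin N) → Fin (c.packets i) → F) (z : ℕ → Fin N → Bool) (l : ℕ) :
    (c.outputs w z l).map erasures = feedback z l := by
  induction l with
  | zero => rfl
  | succ l ih =>
    rw [Code.outputs, List.map_cons, ih, feedback]
    congr 1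
    funext i
    simp only [erasures]
    cases z l i <;> simp

section Decoding

variable {N : ℕ} {F : Type*} [Field F] {K : Fin N → ℕ}

/-- The part of the content of a packet that stems from the source packets of the other users. -/
noncomputable def interference (i : Fin N) (w : (i : Fin N) → Fin (K i) → F) :
    Packet F K →ₗ[F] F where
  toFun p := content p w - ∑ u, p i u * w i u
  map_add' p q := by
    simp only [content, Pi.add_apply, add_mul, Finset.sum_add_distrib]
    ring
  map_smul' t p := by
    simp only [content, Pi.smul_apply, smul_eq_mul, mul_assoc, ← Finset.mul_sum,
      RingHom.id_apply, mul_sub]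

/-- A packet in `Q_S` contains no source packets of the users outside `S`. -/
theorem Rule.apply_eq_zero_of_mem_queue (r : Rule N F) (h : List (Fin N → Bool)) {i : Fin N}
    {S : Finset (Fin N)} (hi : i ∉ S) {p : Packet F K} (hp : p ∈ (r.run K h).queue S) :
    p i = 0 := by
  induction h generalizing S p with
  | nil =>
    simp only [Rule.run, initState, List.mem_flatMap, List.mem_finRange, true_and] at hp
    obtain ⟨j, hp⟩ := hp
    split_ifs at hp with hS
    · simp only [List.mem_map, List.mem_finRange, true_and] at hp
      obtain ⟨u, rfl⟩ := hp
      rw [Pi.single_eq_of_ne]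
      rintro rfl
      simp [hS] at hi
    · simp at hp
  | cons z h ih =>
    cases hc : (r.run K h).current r.order with
    | none =>
      rw [Rule.run_cons_none hc] at hp
      exact ih hi hp
    | some T =>
      rw [Rule.run_cons_some hc] at hp
      simp only [State.act] at hp
      split_ifs at hp with hM
      · rcases List.mem_append.1 hp with hp | hp
        · exact ih hi hp
        · rw [List.mem_singleton] at hp
          have hiT : i ∉ T := fun h => hi (hM.2 ▸ Finset.mem_union_left _ h)
          rw [hp]
          have := comb_mem (W := LinearMap.ker
            (LinearMap.proj (R := F) (φ := fun i => Fin (K i) → F) i))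
            (fun p hp => by simpa using ih hiT hp) (r.used (r.run K h) h)
          simpa using this
      · exact ih hi hp

/-- What user `i` computes is correct: the constants are the interference in the packets of the
queues `Q_S` with `i ∈ S`, the message of user `i` solves its equations, and there is an equation
for every packet in `Q_{D_i}`. -/
theorem Rule.knowledge_correct (r : Rule N F) (K : Fin N → ℕ) (n l : ℕ)
    (w : (i : Fin N) → Fin (K i) → F) (z : ℕ → Fin N → Bool) (i : Fin N) :
    let k := r.knowledge K i (((r.toCode K n).outputs w z l).map fun y => (y i, erasures y))
    let st := r.run K (feedback z l)
    (∀ S, i ∈ S → k.const S = (st.queue S).map (interference i w)) ∧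
    (∀ e ∈ k.eqs, ∑ u, e.1 u * w i u = e.2) ∧
    (∀ p ∈ st.dqueue i, ∃ e ∈ k.eqs, e.1 = p i) := by
  induction l with
  | zero =>
    refine ⟨fun S hS => ?_, by simp [Code.outputs, Rule.knowledge],
      by simp [feedback, Rule.run, initState]⟩
    simp only [Code.outputs, List.map_nil, Rule.knowledge, feedback, Rule.run]
    refine List.map_congr_left fun p hp => ?_
    simp only [initState, List.mem_flatMap, List.mem_finRange, true_and] at hp
    obtain ⟨j, hp⟩ := hp
    split_ifs at hp with hj
    · simp only [List.mem_map, List.mem_finRange, true_and] at hp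
      obtain ⟨u, rfl⟩ := hp
      obtain rfl : i = j := by simpa [hj] using hS
      have h0 : ∀ j, j ≠ i → ∑ v, (Pi.single i (Pi.single u 1) : Packet F K) j v * w j v = 0 :=
        fun j hj => by simp [Pi.single_eq_of_ne hj]
      simp only [interference, content, LinearMap.coe_mk, AddHom.coe_mk]
      rw [Finset.sum_eq_single i (fun j _ hj => h0 j hj) (by simp), sub_self]
    · simp at hp
  | succ l ih =>
    have hfb := Code.outputs_map_erasures (r.toCode K n) w z l
    set ys := (r.toCode K n).outputs w z l with hys
    set st := r.run K (feedback z l) with hst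
    have hsnd : (ys.map fun y => (y i, erasures y)).map Prod.snd = feedback z l := by
      rw [← hfb, List.map_map]
      rfl
    set y : Fin N → Option F :=
      fun j => if z l j then none else some ((r.toCode K n).enc w ys) with hy
    have hyz : erasures y = z l := by
      funext j
      simp only [erasures, hy]
      cases z l j <;> simp
    have hout : (r.toCode K n).outputs w z (l + 1) = y :: ys := rfl
    rw [hout, List.map_cons, feedback]
    simp only at ih ⊢
    cases hc : st.current r.order with
    | none =>
      rw [Rule.run_cons_none hc, Rule.knowledge]
      simp only [hsnd, ← hst, hc]
      exact ih
    | some S =>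
      rw [Rule.run_cons_some hc, Rule.knowledge]
      simp only [hsnd, ← hst, hc, hyz]
      set k := r.knowledge K i (ys.map fun y => (y i, erasures y))
      set a := r.used st (feedback z l) with ha
      obtain ⟨h1, h2, h3⟩ := ih
      have henc : (r.toCode K n).enc w ys = content (comb a (st.queue S)) w := by
        simp only [Rule.toCode, hfb, ← hst, hc, ha]
      set s := comb a (st.queue S) with hs
      have hsi : i ∉ S → s i = 0 := fun hi => by
        have := comb_mem (W := LinearMap.ker
          (LinearMap.proj (R := F) (φ := fun i => Fin (K i) → F) i))
          (fun p hp => by simpa using r.apply_eq_zero_of_mem_queue _ hi hp) a (q := st.queue S)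
        simpa using this
      have hcst : z l i = false → (if i ∈ S then comb a (k.const S) else (y i).getD 0) =
          interference i w s := by
        intro hz
        split_ifs with hi
        · rw [h1 S hi, comb_map]
        · simp [hy, hz, henc, interference, hsi hi]
      have hcst' : i ∈ S → (if i ∈ S then comb a (k.const S) else (y i).getD 0) =
          interference i w s := by
        intro hi
        rw [if_pos hi, h1 S hi, comb_map]
      refine ⟨fun T hT => ?_, fun e he => ?_, fun p hp => ?_⟩
      · simp only [State.act]
        by_cases hM : Moves S (receivers (z l)) ∧ T = S ∪ receivers (z l)
        · rw [if_pos hM, if_pos hM, List.map_append, h1 T hT, List.map_singleton]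
          congr 2
          rw [hM.2, Finset.mem_union] at hT
          rcases hT with hT | hT
          · exact hcst' hT
          · exact hcst (by simpa [receivers] using hT)
        · rw [if_neg hM, if_neg hM]
          exact h1 T hT
      · cases hz : z l i with
        | true =>
          have : y i = none := by simp [hy, hz]
          rw [this] at he
          exact h2 e he
        | false =>
          rw [hcst hz] at he
          have : y i = some (content s w) := by simp [hy, hz, henc]
          rw [this] at he
          rcases List.mem_append.1 he with he | he
          · exact h2 e he
          · rw [List.mem_singleton] at he
            rw [he]
            simp [interference]
      · simp only [State.act] at hp
        cases hz : z l i with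
        | true =>
          have : y i = none := by simp [hy, hz]
          rw [this]
          rw [if_neg (by simp [receivers, hz])] at hp
          exact h3 p hp
        | false =>
          have : y i = some (content s w) := by simp [hy, hz, henc]
          rw [this]
          rw [if_pos (by simp [receivers, hz])] at hp
          rcases List.mem_append.1 hp with hp | hp
          · obtain ⟨e, he, hep⟩ := h3 p hp
            exact ⟨e, List.mem_append_left _ he, hep⟩
          · rw [List.mem_singleton] at hp
            exact ⟨_, List.mem_append_right _ (List.mem_singleton.2 rfl), by rw [hp]⟩

/-- If the algorithm has terminated within the blocklength, then every user recovers its message;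
otherwise every user declares an error. -/
theorem Rule.Admissible.decoded_eq_iff [Finite F] {r : Rule N F} (hr : r.Admissible K) (n : ℕ)
    (w : (i : Fin N) → Fin (K i) → F) (z : ℕ → Fin N → Bool) (i : Fin N) :
    (r.toCode K n).decoded w z i = some (w i) ↔
      (r.run K (feedback z n)).current r.order = none := by
  obtain ⟨-, h2, h3⟩ := r.knowledge_correct K n n w z i
  have hsnd : (((r.toCode K n).outputs w z n).map fun y => (y i, erasures y)).map Prod.snd =
      feedback z n := by
    rw [← Code.outputs_map_erasures (r.toCode K n) w z n, List.map_map]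
    rfl
  change r.decode K i (((r.toCode K n).outputs w z n).map fun y => (y i, erasures y)) = _ ↔ _
  set hh := ((r.toCode K n).outputs w z n).map fun y => (y i, erasures y)
  constructor
  · intro h
    by_contra hc
    rw [Rule.decode, dif_neg (by rw [hsnd]; exact fun h => hc h.1)] at h
    simp at h
  · intro hc
    have huniq : ∀ x : Fin (K i) → F,
        (∀ e ∈ (r.knowledge K i hh).eqs, ∑ u, e.1 u * x u = e.2) → x = w i := by
      intro x hx
      -- The functional `b ↦ b ⬝ᵥ (x - w i)` vanishes on the vectors of the equations, which span.
      let φ : (Fin (K i) → F) →ₗ[F] F :=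
        { toFun := fun b => b ⬝ᵥ (x - w i)
          map_add' := fun b b' => add_dotProduct _ _ _
          map_smul' := fun t b => smul_dotProduct _ _ _ }
      have hφ : ∀ b, φ b = 0 := by
        intro b
        have hb : b ∈ Submodule.span F {b | ∃ p ∈ (r.run K (feedback z n)).dqueue i, b = p i} := by
          rw [hr.span_dqueue_eq_top hc i]
          trivial
        have hle : Submodule.span F {b | ∃ p ∈ (r.run K (feedback z n)).dqueue i, b = p i} ≤
            LinearMap.ker φ := by
          rw [Submodule.span_le]
          rintro _ ⟨p, hp, rfl⟩
          obtain ⟨e, he, hep⟩ := h3 p hp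
          have e1 := hx e he
          have e2 := h2 e he
          change p i ⬝ᵥ (x - w i) = 0
          rw [dotProduct_sub, ← hep, sub_eq_zero]
          exact e1.trans e2.symm
        exact hle hb
      have : x - w i = 0 := dotProduct_eq_zero _ fun b => by
        rw [dotProduct_comm]
        exact hφ b
      exact sub_eq_zero.1 this
    have hx : (r.run K (hh.map Prod.snd)).current r.order = none ∧
        ∃! x : Fin (K i) → F, ∀ e ∈ (r.knowledge K i hh).eqs, ∑ u, e.1 u * x u = e.2 :=
      ⟨by rw [hsnd]; exact hc, w i, h2, huniq⟩
    rw [Rule.decode, dif_pos hx, huniq _ hx.2.choose_spec.1]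

/-- For every message, the error event is that the algorithm has not terminated in time. -/
theorem Rule.Admissible.avgError_eq [Fintype F] {Ω : Type*} [MeasurableSpace Ω]
    {P : Measure Ω} {Z : ℕ → Ω → Fin N → Bool} {r : Rule N F} (hr : r.Admissible K) (n : ℕ) :
    (r.toCode K n).avgError P Z =
      P.real {ω | (r.run K (feedback (fun l => Z l ω) n)).current r.order ≠ none} := by
  have key : ∀ w, (r.toCode K n).errorProb P Z w =
      P.real {ω | (r.run K (feedback (fun l => Z l ω) n)).current r.order ≠ none} := by
    intro w
    rw [Code.errorProb]
    congr 1
    ext ω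
    constructor
    · rintro ⟨i, hi⟩
      exact fun h => hi ((hr.decoded_eq_iff n w _ i).2 h)
    · intro h
      obtain ⟨S, hS⟩ := Option.ne_none_iff_exists'.1 h
      obtain ⟨i, -, -⟩ := State.exists_of_current hS
      exact ⟨i, fun h' => h ((hr.decoded_eq_iff n w _ i).1 h')⟩
  rw [Code.avgError, Finset.sum_congr rfl fun w _ => key w, Finset.sum_const, nsmul_eq_mul,
    Finset.card_univ]
  exact mul_div_cancel_left₀ _ (by
    have : Nonempty ((i : Fin N) → Fin ((r.toCode K n).packets i) → F) := ⟨fun _ _ => 0⟩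
    exact_mod_cast Fintype.card_ne_zero)

end Decoding

/-! ### The coefficients `fhat` solve the flow equations of a unit of an index -/

section Moebius

variable {α : Type*} [DecidableEq α]

/-- Möbius inversion on the lattice of finite sets. -/
theorem sum_powerset_moebius (φ : Finset α → ℝ) (X : Finset α) :
    ∑ H ∈ X.powerset, ∑ H' ∈ H.powerset, (-1 : ℝ) ^ (H.card - H'.card) * φ H' = φ X := by
  rw [Finset.sum_comm' (t' := X.powerset) (s' := fun H' => Finset.Icc H' X) (by
    intro H H'
    simp only [Finset.mem_powerset, Finset.mem_Icc]
    exact ⟨fun h => ⟨⟨h.2, h.1⟩, h.2.trans h.1⟩, fun h => ⟨h.1.2, h.1.1⟩⟩)]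
  rw [Finset.sum_eq_single X]
  · simp
  · intro H hH hne
    rw [Finset.mem_powerset] at hH
    rw [Finset.Icc_eq_image_powerset hH, Finset.sum_image]
    · have : ∀ J ∈ (X \ H).powerset,
          (-1 : ℝ) ^ ((H ∪ J).card - H.card) * φ H = (-1 : ℝ) ^ J.card * φ H := by
        intro J hJ
        rw [Finset.mem_powerset] at hJ
        have hd : Disjoint H J := Finset.disjoint_of_subset_right hJ Finset.disjoint_sdiff
        rw [Finset.card_union_of_disjoint hd, Nat.add_sub_cancel_left]
      rw [Finset.sum_congr rfl this, ← Finset.sum_mul]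
      have h0 := Finset.sum_powerset_neg_one_pow_card_of_nonempty (x := X \ H)
        (Finset.sdiff_nonempty.2 fun h => hne (hH.antisymm h))
      have h1 : ∑ J ∈ (X \ H).powerset, (-1 : ℝ) ^ J.card = 0 := by exact_mod_cast h0
      rw [h1, zero_mul]
    · intro J hJ J' hJ' h
      simp only [Finset.coe_powerset, Set.mem_preimage, Set.mem_powerset_iff,
        Finset.coe_subset] at hJ hJ'
      have e : ∀ J : Finset α, J ⊆ X \ H → (H ∪ J) \ H = J := fun J hJ => by
        rw [Finset.union_sdiff_left]
        exact Finset.sdiff_eq_self_of_disjoint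
          (Finset.disjoint_of_subset_left hJ Finset.sdiff_disjoint)
      rw [← e J hJ, ← e J' hJ']
      exact congrArg (· \ H) h
  · simp

/-- Let a process on finite sets start at `∅`, and let it go in each step from `H` to `H ∪ J` with
probability `g J`. If `f H` denotes the expected time spent at `H`, then `∑ H ⊆ X, f H` is the
expected time `(1 - ∑ J ⊆ X, g J)⁻¹` until the process leaves the subsets of `X`, so that `f` is
given by Möbius inversion. The balance equation of this process holds accordingly. -/
theorem moebius_balance (g : Finset α → ℝ) (H : Finset α)
    (hw : ∀ X ⊆ H, ∑ J ∈ X.powerset, g J ≠ 1) :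
    let f : Finset α → ℝ := fun H => ∑ H' ∈ H.powerset,
      (-1 : ℝ) ^ (H.card - H'.card) * (1 - ∑ J ∈ H'.powerset, g J)⁻¹
    f H = (if H = ∅ then 1 else 0) +
      ∑ H' ∈ H.powerset, (∑ J ∈ H.powerset with H' ∪ J = H, g J) * f H' := by
  intro f
  set R : Finset α → ℝ := fun H => (if H = ∅ then 1 else 0) +
      ∑ H' ∈ H.powerset, (∑ J ∈ H.powerset with H' ∪ J = H, g J) * f H' with hR
  have hf : ∀ X : Finset α, ∑ H ∈ X.powerset, f H = (1 - ∑ J ∈ X.powerset, g J)⁻¹ :=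
    fun X => sum_powerset_moebius (fun X => (1 - ∑ J ∈ X.powerset, g J)⁻¹) X
  -- The two sides have the same sums over the subsets of every `X`, hence agree by induction.
  have hRf : ∀ X ⊆ H, ∑ H ∈ X.powerset, R H = ∑ H ∈ X.powerset, f H := by
    intro X hX
    have h1 : ∑ H ∈ X.powerset, (if H = ∅ then (1 : ℝ) else 0) = 1 := by simp
    have h2 : ∑ H ∈ X.powerset, ∑ H' ∈ H.powerset,
        (∑ J ∈ H.powerset with H' ∪ J = H, g J) * f H' =
        (∑ J ∈ X.powerset, g J) * ∑ H' ∈ X.powerset, f H' := by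
      rw [Finset.sum_mul_sum]
      have e1 : ∀ H ∈ X.powerset, ∑ H' ∈ H.powerset,
          (∑ J ∈ H.powerset with H' ∪ J = H, g J) * f H' =
          ∑ H' ∈ X.powerset, ∑ J ∈ X.powerset, if H' ∪ J = H then g J * f H' else 0 := by
        intro H hH
        rw [Finset.mem_powerset] at hH
        have hsub : H.powerset ⊆ X.powerset := Finset.powerset_mono.2 hH
        refine Eq.trans ?_ (Finset.sum_subset hsub ?_)
        · refine Finset.sum_congr rfl fun H' _ => ?_
          rw [Finset.sum_mul, Finset.sum_filter]
          refine Finset.sum_subset hsub fun J _ hJ => if_neg ?_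
          rintro rfl
          exact hJ (Finset.mem_powerset.2 Finset.subset_union_right)
        · intro H' _ hH'
          refine Finset.sum_eq_zero fun J _ => if_neg ?_
          rintro rfl
          exact hH' (Finset.mem_powerset.2 Finset.subset_union_left)
      rw [Finset.sum_congr rfl e1, Finset.sum_comm, Finset.sum_comm (s := X.powerset)
        (t := X.powerset) (f := fun J H' => g J * f H')]
      refine Finset.sum_congr rfl fun H' hH' => ?_
      rw [Finset.sum_comm]
      refine Finset.sum_congr rfl fun J hJ => ?_
      rw [Finset.sum_ite_eq, if_pos]
      rw [Finset.mem_powerset] at *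
      exact Finset.union_subset hH' hJ
    have h3 := sub_ne_zero.2 (hw X hX).symm
    simp only [hR]
    rw [Finset.sum_add_distrib, h1, h2, hf]
    field_simp
    ring
  have key : ∀ X ⊆ H, R X = f X := by
    intro X
    induction X using Finset.strongInduction with
    | H X ih =>
      intro hX
      have h := hRf X hX
      rw [← Finset.add_sum_erase _ _ (Finset.mem_powerset_self X),
        ← Finset.add_sum_erase _ f (Finset.mem_powerset_self X),
        Finset.sum_congr rfl (g := f) fun Y hY => ?_] at h
      · exact add_right_cancel h
      · obtain ⟨hne, hY⟩ := Finset.mem_erase.1 hY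
        rw [Finset.mem_powerset] at hY
        exact ih Y (hY.ssubset_of_ne hne) (hY.trans hX)
  exact (key H subset_rfl).symm

end Moebius

section Balance

variable {N : ℕ}

/-- The erasures for which a unit of `K^i_S` leaves the queue `Q_S`. -/
def departs (i : Fin N) (S : Finset (Fin N)) : Set (Fin N → Bool) :=
  {z | i ∈ receivers z ∨ Moves S (receivers z)}

/-- The erasures for which a unit of `K^i_S` becomes a unit of `K^i_T`. -/
def transfers (i : Fin N) (S T : Finset (Fin N)) : Set (Fin N → Bool) :=
  {z | i ∉ receivers z ∧ S ∪ receivers z = T}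

theorem departs_eq_compl_transfers {i : Fin N} {S : Finset (Fin N)} (hi : i ∈ S) :
    departs i S = (transfers i S S)ᶜ := by
  ext z
  simp only [departs, transfers, Set.mem_ofPred_eq, Set.mem_compl_iff, not_and,
    Finset.union_eq_left]
  constructor
  · rintro (h | ⟨_, j, hj, hjS⟩) hG hsub
    · exact hG h
    · exact hjS (hsub hj)
  · intro h
    by_cases hG : i ∈ receivers z
    · exact Or.inl hG
    · obtain ⟨j, hj, hjS⟩ := Finset.not_subset.1 (h hG)
      exact Or.inr ⟨⟨i, hi, hG⟩, j, hj, hjS⟩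

variable {Ω : Type*} [MeasurableSpace Ω] {P : Measure Ω} {Z : ℕ → Ω → Fin N → Bool}

theorem real_receivers [IsFiniteMeasure P] (hZ : Measurable (Z 0)) (D : Finset (Fin N) → Prop)
    [DecidablePred D] : P.real {ω | D (receivers (Z 0 ω))} =
      ∑ J with D J, P.real {ω | receivers (Z 0 ω) = J} := by
  rw [← measureReal_biUnion_finset]
  · congr 1
    ext ω
    simp
  · intro J _ J' _ hne
    refine Set.disjoint_left.2 fun ω h h' => hne ?_
    exact Eq.trans (Eq.symm h) h'
  · intro J _
    exact hZ (MeasurableSet.of_discrete (s := {z | receivers z = J}))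

theorem real_departs_pos [IsProbabilityMeasure P] (hZ : Measurable (Z 0)) {i : Fin N}
    (hε : eps P Z {i} < 1) (S : Finset (Fin N)) : 0 < P.real (Z 0 ⁻¹' departs i S) := by
  have h1 : P.real (Z 0 ⁻¹' {z | z i = true})ᶜ = 1 - eps P Z {i} := by
    rw [probReal_compl_eq_one_sub (hZ (MeasurableSet.of_discrete))]
    simp [eps]
  have h2 : P.real (Z 0 ⁻¹' {z | z i = true})ᶜ ≤ P.real (Z 0 ⁻¹' departs i S) := by
    refine measureReal_mono ?_
    intro ω hω
    exact Or.inl (by simpa [receivers] using hω)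
  linarith

/-- The expected number `fhat` of slots in which a unit of an index of user `i` is active at `Q_S`
satisfies: departures from `Q_S` equal arrivals at `Q_S`. -/
theorem fhat_balance [IsProbabilityMeasure P] (hZ : Measurable (Z 0)) {i : Fin N}
    (hε : eps P Z {i} < 1) {S : Finset (Fin N)} (hi : i ∈ S) :
    P.real (Z 0 ⁻¹' departs i S) * fhat (eps P Z) i S = (if S = {i} then 1 else 0) +
      ∑ S' with i ∈ S' ∧ S' ⊂ S, P.real (Z 0 ⁻¹' transfers i S' S) * fhat (eps P Z) i S' := by
  -- The process of `moebius_balance` is the set `S.erase i`, with `g` the law of the receivers.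
  set g : Finset (Fin N) → ℝ := fun J => P.real {ω | receivers (Z 0 ω) = J} with hg
  have heps : ∀ X, eps P Z (Finset.univ \ X) = ∑ J ∈ X.powerset, g J := by
    intro X
    have : ∀ ω, (∀ j ∈ Finset.univ \ X, Z 0 ω j = true) ↔ receivers (Z 0 ω) ∈ X.powerset := by
      intro ω
      rw [Finset.mem_powerset]
      constructor
      · intro h j hj
        by_contra hX
        have := h j (by simpa using hX)
        simp [receivers, this] at hj
      · intro h j hj
        by_contra hz
        rw [Finset.mem_sdiff] at hj
        exact hj.2 (h (by simpa [receivers] using hz))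
    simp only [eps, this]
    rw [real_receivers hZ fun J => J ∈ X.powerset, Finset.filter_mem_eq_inter,
      Finset.univ_inter]
  set f : Finset (Fin N) → ℝ := fun H => ∑ H' ∈ H.powerset,
      (-1 : ℝ) ^ (H.card - H'.card) * (1 - ∑ J ∈ H'.powerset, g J)⁻¹ with hf
  have hfhat : ∀ T, i ∈ T → fhat (eps P Z) i T = f (T.erase i) := by
    intro T hT
    simp only [fhat, hf]
    refine Finset.sum_congr rfl fun H _ => ?_
    rw [heps, div_eq_mul_inv, Finset.card_erase_of_mem hT]
    congr 2
    omega
  have hw : ∀ X ⊆ S.erase i, ∑ J ∈ X.powerset, g J ≠ 1 := by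
    intro X hX
    rw [← heps]
    refine ne_of_lt (lt_of_le_of_lt (measureReal_mono ?_) hε)
    intro ω hω j hj
    rw [Finset.mem_singleton] at hj
    subst hj
    exact hω j (by simpa using fun h => Finset.notMem_erase j S (hX h))
  have hbal : f (S.erase i) = (if S.erase i = ∅ then 1 else 0) +
      ∑ H' ∈ (S.erase i).powerset,
        (∑ J ∈ (S.erase i).powerset with H' ∪ J = S.erase i, g J) * f H' :=
    moebius_balance g (S.erase i) hw
  have htr : ∀ S', i ∈ S' → S' ⊆ S → P.real (Z 0 ⁻¹' transfers i S' S) =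
      ∑ J ∈ (S.erase i).powerset with S'.erase i ∪ J = S.erase i, g J := by
    intro S' hiS' hS'
    change P.real {ω | i ∉ receivers (Z 0 ω) ∧ S' ∪ receivers (Z 0 ω) = S} = _
    rw [real_receivers hZ fun J => i ∉ J ∧ S' ∪ J = S]
    refine Finset.sum_congr ?_ fun _ _ => rfl
    ext J
    simp only [Finset.mem_filter, Finset.mem_univ, true_and, Finset.mem_powerset]
    constructor
    · rintro ⟨hiJ, rfl⟩
      have e : (S' ∪ J).erase i = S'.erase i ∪ J := by
        rw [Finset.erase_union_distrib, Finset.erase_eq_of_notMem hiJ]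
      rw [e]
      exact ⟨Finset.subset_union_right, rfl⟩
    · rintro ⟨hJ, e⟩
      refine ⟨fun h => Finset.notMem_erase i S (hJ h), ?_⟩
      rw [← Finset.insert_erase hiS', Finset.insert_union, e, Finset.insert_erase hi]
  have hsum : ∑ H' ∈ (S.erase i).powerset,
      (∑ J ∈ (S.erase i).powerset with H' ∪ J = S.erase i, g J) * f H' =
      ∑ S' with i ∈ S' ∧ S' ⊆ S, P.real (Z 0 ⁻¹' transfers i S' S) * fhat (eps P Z) i S' := by
    symm
    refine Finset.sum_bij' (fun S' _ => S'.erase i) (fun H _ => insert i H) ?_ ?_ ?_ ?_ ?_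
    · intro S' hS'
      simp only [Finset.mem_filter, Finset.mem_univ, true_and, Finset.mem_powerset] at hS' ⊢
      exact Finset.erase_subset_erase i hS'.2
    · intro H hH
      simp only [Finset.mem_filter, Finset.mem_univ, true_and, Finset.mem_powerset] at hH ⊢
      exact ⟨Finset.mem_insert_self _ _,
        Finset.insert_subset hi (hH.trans (Finset.erase_subset _ _))⟩
    · intro S' hS'
      simp only [Finset.mem_filter, Finset.mem_univ, true_and] at hS'
      exact Finset.insert_erase hS'.1
    · intro H hH
      rw [Finset.mem_powerset] at hH
      exact Finset.erase_insert fun h => Finset.notMem_erase i S (hH h)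
    · intro S' hS'
      simp only [Finset.mem_filter, Finset.mem_univ, true_and] at hS'
      rw [htr S' hS'.1 hS'.2, hfhat S' hS'.1]
  have hsplit : ∑ S' with i ∈ S' ∧ S' ⊆ S,
      P.real (Z 0 ⁻¹' transfers i S' S) * fhat (eps P Z) i S' =
      P.real (Z 0 ⁻¹' transfers i S S) * fhat (eps P Z) i S +
      ∑ S' with i ∈ S' ∧ S' ⊂ S, P.real (Z 0 ⁻¹' transfers i S' S) * fhat (eps P Z) i S' := by
    rw [← Finset.add_sum_erase _ _ (a := S) (by simpa using hi)]
    congr 2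
    ext S'
    simp only [Finset.mem_erase, Finset.mem_filter, Finset.mem_univ, true_and,
      ssubset_iff_subset_ne]
    tauto
  have hdep : P.real (Z 0 ⁻¹' departs i S) = 1 - P.real (Z 0 ⁻¹' transfers i S S) := by
    rw [departs_eq_compl_transfers hi, Set.preimage_compl,
      probReal_compl_eq_one_sub (hZ (MeasurableSet.of_discrete))]
  have hempty : S.erase i = ∅ ↔ S = {i} := by
    rw [Finset.erase_eq_empty_iff]
    exact ⟨fun h => h.resolve_left (Finset.ne_empty_of_mem hi), Or.inr⟩
  rw [hsum, hsplit, ← hfhat S hi] at hbal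
  simp only [hempty] at hbal
  rw [hdep]
  linarith

end Balance

/-! ### Counting slots -/

section Tally

variable {N : ℕ}

open Classical in
/-- The number of slots which satisfy `q`, a condition on the feedback of the previous slots, and
whose erasures are in `E`. -/
noncomputable def tally (q : List (Fin N → Bool) → Prop) (E : Set (Fin N → Bool)) :
    List (Fin N → Bool) → ℕ
  | [] => 0
  | z :: h => tally q E h + if q h ∧ z ∈ E then 1 else 0

theorem tally_cons_of_pos {q : List (Fin N → Bool) → Prop} {E : Set (Fin N → Bool)}
    {z : Fin N → Bool} {h : List (Fin N → Bool)} (hq : q h) (hz : z ∈ E) :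
    tally q E (z :: h) = tally q E h + 1 := by
  rw [tally, if_pos ⟨hq, hz⟩]

theorem tally_cons_of_neg {q : List (Fin N → Bool) → Prop} {E : Set (Fin N → Bool)}
    {z : Fin N → Bool} {h : List (Fin N → Bool)} (hq : ¬(q h ∧ z ∈ E)) :
    tally q E (z :: h) = tally q E h := by
  rw [tally, if_neg hq, add_zero]

theorem tally_mono {q q' : List (Fin N → Bool) → Prop} (hq : ∀ h, q h → q' h)
    (E : Set (Fin N → Bool)) (h : List (Fin N → Bool)) : tally q E h ≤ tally q' E h := by
  induction h with
  | nil => rfl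
  | cons z h ih =>
    by_cases hz : q h ∧ z ∈ E
    · rw [tally_cons_of_pos hz.1 hz.2, tally_cons_of_pos (hq h hz.1) hz.2]
      omega
    · rw [tally_cons_of_neg hz, tally]
      omega

variable {F : Type*} [Field F] {K : Fin N → ℕ}

/-- The queue `Q_S` is in process. -/
def Rule.Serves (r : Rule N F) (K : Fin N → ℕ) (S : Finset (Fin N)) (h : List (Fin N → Bool)) :
    Prop :=
  (r.run K h).current r.order = some S

/-- The queue `Q_S` is in process, and `K^i_S` is still positive. -/
def Rule.Active (r : Rule N F) (K : Fin N → ℕ) (i : Fin N) (S : Finset (Fin N))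
    (h : List (Fin N → Bool)) : Prop :=
  r.Serves K S h ∧ 0 < (r.run K h).cnt i S

/-- The index `K^i_T` is its initial value, plus the arrivals from smaller queues, minus the
departures. -/
theorem Rule.cnt_balance (r : Rule N F) (h : List (Fin N → Bool)) {i : Fin N}
    {T : Finset (Fin N)} (hi : i ∈ T) :
    (r.run K h).cnt i T + tally (r.Active K i T) (departs i T) h =
      (if T = {i} then K i else 0) +
        ∑ S with i ∈ S ∧ S ⊂ T, tally (r.Active K i S) (transfers i S T) h := by
  induction h with
  | nil => simp [Rule.run, initState, tally]
  | cons z h ih =>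
    cases hc : (r.run K h).current r.order with
    | none =>
      have hna : ∀ S, ¬r.Active K i S h := fun S hS => by
        have := hS.1
        simp [Rule.Serves, hc] at this
      have ht : ∀ S E, tally (r.Active K i S) E (z :: h) = tally (r.Active K i S) E h :=
        fun S E => tally_cons_of_neg fun h => hna S h.1
      simp only [Rule.run_cons_none hc, ht]
      exact ih
    | some S =>
      have hact : ∀ S', r.Active K i S' h ↔ S' = S ∧ 0 < (r.run K h).cnt i S' := by
        intro S'
        rw [Rule.Active, Rule.Serves, hc, Option.some_inj, eq_comm]
      have hD0 : ¬(T = S ∧ 0 < (r.run K h).cnt i T ∧ z ∈ departs i T) →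
          tally (r.Active K i T) (departs i T) (z :: h) =
            tally (r.Active K i T) (departs i T) h := fun hn =>
        tally_cons_of_neg fun h => hn ⟨((hact T).1 h.1).1, ((hact T).1 h.1).2, h.2⟩
      have hM0 : ¬(i ∈ S ∧ S ⊂ T ∧ 0 < (r.run K h).cnt i S ∧ z ∈ transfers i S T) →
          ∑ S with i ∈ S ∧ S ⊂ T, tally (r.Active K i S) (transfers i S T) (z :: h) =
            ∑ S with i ∈ S ∧ S ⊂ T, tally (r.Active K i S) (transfers i S T) h := by
        intro hn
        refine Finset.sum_congr rfl fun S' hS' => tally_cons_of_neg fun h => hn ?_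
        obtain ⟨rfl, hp⟩ := (hact S').1 h.1
        simp only [Finset.mem_filter, Finset.mem_univ, true_and] at hS'
        exact ⟨hS'.1, hS'.2, hp, h.2⟩
      rw [Rule.run_cons_some hc]
      rcases (r.run K h).act_cases S (receivers z) (r.used (r.run K h) h) i with
        ⟨hn, h1, -⟩ | ⟨hS, hp, hG, h1, -⟩ | ⟨hS, hp, hG, hM, hne, h1, -⟩
      · rw [h1, hD0, hM0, ih]
        · rintro ⟨hS, hST, hp, hiG, hz⟩
          refine hn ⟨hS, hp, ?_⟩
          have : z ∈ departs i S := by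
            rw [departs_eq_compl_transfers hS]
            exact fun h => hST.ne (h.2.symm.trans hz)
          exact this
        · rintro ⟨rfl, hp, hz⟩
          exact hn ⟨hi, hp, hz⟩
      · rw [h1, hM0 fun h => h.2.2.2.1 hG]
        by_cases hTS : T = S
        · subst hTS
          rw [Function.update_self, tally_cons_of_pos ((hact T).2 ⟨rfl, hp⟩) (Or.inl hG)]
          omega
        · rw [Function.update_of_ne hTS, hD0 fun h => hTS h.1, ih]
      · rw [h1]
        by_cases hTS : T = S
        · subst hTS
          rw [Function.update_of_ne hne.symm, Function.update_self,
            tally_cons_of_pos ((hact T).2 ⟨rfl, hp⟩) (Or.inr hM), hM0 fun h => h.2.1.ne rfl]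
          omega
        · rw [hD0 fun h => hTS h.1]
          by_cases hTG : T = S ∪ receivers z
          · have hST : S ⊂ T := by
              rw [hTG]
              exact Finset.subset_union_left.ssubset_of_ne hne.symm
            have hmem : S ∈ Finset.univ.filter fun S => i ∈ S ∧ S ⊂ T := by simp [hS, hST]
            rw [← Finset.add_sum_erase _ _ hmem] at ih ⊢
            have hz : z ∈ transfers i S T := ⟨hG, hTG.symm⟩
            rw [tally_cons_of_pos ((hact S).2 ⟨rfl, hp⟩) hz,
              Finset.sum_congr rfl fun S' hS' => tally_cons_of_neg fun h =>
                Finset.ne_of_mem_erase hS' ((hact S').1 h.1).1, hTG, Function.update_self]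
            rw [hTG] at ih
            omega
          · rw [Function.update_of_ne hTG, Function.update_of_ne hTS, hM0, ih]
            exact fun h => hTG h.2.2.2.2.symm

/-- An index can only grow while a queue of a strictly smaller set is in process. -/
theorem Rule.cnt_cons_le (r : Rule N F) (K : Fin N → ℕ) (z : Fin N → Bool)
    (h : List (Fin N → Bool)) (i : Fin N) (T : Finset (Fin N)) :
    (r.run K (z :: h)).cnt i T ≤ (r.run K h).cnt i T ∨
      ∃ S, r.Serves K S h ∧ S ⊂ T := by
  cases hc : (r.run K h).current r.order with
  | none => exact Or.inl (by rw [Rule.run_cons_none hc])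
  | some S =>
    rw [Rule.run_cons_some hc]
    rcases (r.run K h).act_cases S (receivers z) (r.used (r.run K h) h) i with
        ⟨-, h1, -⟩ | ⟨-, -, -, h1, -⟩ | ⟨-, -, -, -, hne, h1, -⟩
    · exact Or.inl (by rw [h1])
    · left
      rw [h1]
      by_cases hTS : T = S
      · subst hTS
        simp
      · rw [Function.update_of_ne hTS]
    · by_cases hTG : T = S ∪ receivers z
      · right
        refine ⟨S, hc, ?_⟩
        rw [hTG]
        exact Finset.subset_union_left.ssubset_of_ne hne.symm
      · left
        rw [h1, Function.update_of_ne hTG]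
        by_cases hTS : T = S
        · subst hTS
          simp
        · rw [Function.update_of_ne hTS]

/-- Once the processing of `Q_S` has begun, all indices of lower levels are zero for ever. -/
theorem Rule.Admissible.cnt_eq_zero_of_tally_ne_zero {r : Rule N F} (hr : r.Admissible K)
    {S : Finset (Fin N)} {h : List (Fin N → Bool)} (hS : tally (r.Serves K S) Set.univ h ≠ 0)
    {T : Finset (Fin N)} (hT : T.card < S.card) {i : Fin N} (hi : i ∈ T) :
    (r.run K h).cnt i T = 0 := by
  induction h generalizing T i with
  | nil => simp [tally] at hS
  | cons z h ih =>
    have hzero : ∀ {T : Finset (Fin N)}, T.card < S.card → ∀ {i}, i ∈ T →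
        (r.run K h).cnt i T = 0 := by
      intro T hT i hi
      by_cases hs : r.Serves K S h
      · obtain ⟨-, l₁, l₂, hl, hl₁⟩ := List.find?_eq_some_iff_append.1 hs
        have hmem := (hr.mem_order T).2 ⟨i, hi⟩
        have hlev := hr.levels
        rw [hl] at hmem hlev
        rcases List.mem_append.1 hmem with hm | hm
        · have := hl₁ T hm
          simp only [Bool.not_eq_eq_eq_not, Bool.not_true, decide_eq_false_iff_not, not_exists,
            not_and, not_lt, Nat.le_zero] at this
          exact this i hi
        · rcases List.mem_cons.1 hm with rfl | hm
          · omega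
          · have := (List.pairwise_cons.1 (List.pairwise_append.1 hlev).2.1).1 T hm
            omega
      · rw [tally_cons_of_neg fun h => hs h.1] at hS
        exact ih hS hT hi
    rcases r.cnt_cons_le K z h i T with h1 | ⟨S', hS', hST⟩
    · have := hzero hT hi
      omega
    · obtain ⟨j, hj, hp⟩ := State.exists_of_current hS'
      have := hzero ((Finset.card_lt_card hST).trans hT) hj
      omega

/-- A user with the longest activity at `Q_S` is active in all slots in which `Q_S` is processed. -/
theorem Rule.Admissible.exists_tally_active_eq {r : Rule N F} (hr : r.Admissible K)
    {S : Finset (Fin N)} (hS : S.Nonempty) (h : List (Fin N → Bool)) :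
    ∃ i ∈ S, tally (r.Active K i S) Set.univ h = tally (r.Serves K S) Set.univ h := by
  have hle : ∀ i h, tally (r.Active K i S) Set.univ h ≤ tally (r.Serves K S) Set.univ h :=
    fun i h => tally_mono (fun _ h => h.1) _ h
  -- The induction needs more: every user whose index is still positive has always been active.
  suffices H : (∃ i ∈ S, tally (r.Active K i S) Set.univ h = tally (r.Serves K S) Set.univ h) ∧
      ∀ i ∈ S, 0 < (r.run K h).cnt i S →
        tally (r.Active K i S) Set.univ h = tally (r.Serves K S) Set.univ h from H.1
  induction h with
  | nil =>
    obtain ⟨i, hi⟩ := hS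
    exact ⟨⟨i, hi, rfl⟩, fun _ _ _ => rfl⟩
  | cons z h ih =>
    by_cases hs : r.Serves K S h
    · have hcont : ∀ i ∈ S, 0 < (r.run K h).cnt i S →
          tally (r.Active K i S) Set.univ (z :: h) = tally (r.Serves K S) Set.univ (z :: h) := by
        intro i hi hp
        rw [tally_cons_of_pos (show r.Active K i S h from ⟨hs, hp⟩) (Set.mem_univ _),
          tally_cons_of_pos hs (Set.mem_univ _), ih.2 i hi hp]
      obtain ⟨i, hi, hp⟩ := State.exists_of_current hs
      refine ⟨⟨i, hi, hcont i hi hp⟩, fun j hj hp => hcont j hj ?_⟩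
      rcases r.cnt_cons_le K z h j S with h1 | ⟨S', hS', hSS⟩
      · omega
      · rw [Rule.Serves, Option.some_inj.2 rfl] at hS'
        rw [Rule.Serves, hS', Option.some_inj] at hs
        exact absurd hs hSS.ne
    · have e1 : ∀ i, tally (r.Active K i S) Set.univ (z :: h) =
          tally (r.Active K i S) Set.univ h := fun i => tally_cons_of_neg fun h => hs h.1.1
      have e2 : tally (r.Serves K S) Set.univ (z :: h) = tally (r.Serves K S) Set.univ h :=
        tally_cons_of_neg fun h => hs h.1
      simp only [e1, e2]
      refine ⟨ih.1, fun i hi hp => ?_⟩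
      by_cases h0 : tally (r.Serves K S) Set.univ h = 0
      · have := hle i h
        omega
      · refine ih.2 i hi ?_
        rcases r.cnt_cons_le K z h i S with h1 | ⟨S', hS', hSS⟩
        · omega
        · obtain ⟨j, hj, hp⟩ := State.exists_of_current hS'
          have := hr.cnt_eq_zero_of_tally_ne_zero h0 (Finset.card_lt_card hSS) hj
          omega

/-- Exactly one queue is processed in each slot before termination, and none after it. -/
theorem Rule.sum_tally_serves_cons (r : Rule N F) (z : Fin N → Bool) (h : List (Fin N → Bool)) :
    ∑ S : {S : Finset (Fin N) // S.Nonempty}, tally (r.Serves K S.1) Set.univ (z :: h) =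
      (∑ S : {S : Finset (Fin N) // S.Nonempty}, tally (r.Serves K S.1) Set.univ h) +
        if (r.run K h).current r.order = none then 0 else 1 := by
  cases hc : (r.run K h).current r.order with
  | none =>
    rw [if_pos rfl, add_zero]
    refine Finset.sum_congr rfl fun S _ => tally_cons_of_neg fun h => ?_
    have := h.1
    rw [Rule.Serves, hc] at this
    simp at this
  | some S =>
    obtain ⟨i, hi, -⟩ := State.exists_of_current hc
    have hmem := Finset.mem_univ (⟨S, i, hi⟩ : {S : Finset (Fin N) // S.Nonempty})
    rw [← Finset.add_sum_erase _ _ hmem, ← Finset.add_sum_erase _ _ hmem,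
      tally_cons_of_pos (show r.Serves K S h from hc) (Set.mem_univ _),
      Finset.sum_congr rfl fun S' hS' => tally_cons_of_neg fun h => ?_]
    · simp
      ring
    · have := h.1
      rw [Rule.Serves, hc, Option.some_inj] at this
      exact Finset.ne_of_mem_erase hS' (Subtype.ext this.symm)

theorem Rule.sum_tally_serves_le (r : Rule N F) (h : List (Fin N → Bool)) :
    ∑ S : {S : Finset (Fin N) // S.Nonempty}, tally (r.Serves K S.1) Set.univ h ≤ h.length := by
  induction h with
  | nil => simp [tally]
  | cons z h ih =>
    rw [r.sum_tally_serves_cons, List.length_cons]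
    split_ifs <;> omega

theorem Rule.sum_tally_serves_eq (r : Rule N F) {h : List (Fin N → Bool)}
    (hc : (r.run K h).current r.order ≠ none) :
    ∑ S : {S : Finset (Fin N) // S.Nonempty}, tally (r.Serves K S.1) Set.univ h = h.length := by
  induction h with
  | nil => simp [tally]
  | cons z h ih =>
    have hc' : (r.run K h).current r.order ≠ none := fun h0 => by
      rw [Rule.run_cons_none h0] at hc
      exact hc h0
    rw [r.sum_tally_serves_cons, if_neg hc', ih hc', List.length_cons]

end Tally

/-! ### Typical feedback determines the processing times -/

/-- Subsolutions of the homogeneous flow equations with small defect are small, by induction along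
the inclusion of sets. -/
theorem exists_flow_bound {N : ℕ} (i : Fin N) {pD : Finset (Fin N) → ℝ}
    {pM : Finset (Fin N) → Finset (Fin N) → ℝ} (hD : ∀ S, 0 < pD S) (hM : ∀ S T, 0 ≤ pM S T) :
    ∃ C : ℝ, 0 ≤ C ∧ ∀ (y : Finset (Fin N) → ℝ) (η : ℝ), 0 ≤ η →
      (∀ T, i ∈ T → pD T * y T ≤ ∑ S with i ∈ S ∧ S ⊂ T, pM S T * y S + η) →
      ∀ T, i ∈ T → y T ≤ C * η := by
  have H : ∀ T, ∃ C : ℝ, 0 ≤ C ∧ ∀ (y : Finset (Fin N) → ℝ) (η : ℝ), 0 ≤ η →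
      (∀ T, i ∈ T → pD T * y T ≤ ∑ S with i ∈ S ∧ S ⊂ T, pM S T * y S + η) →
      i ∈ T → y T ≤ C * η := by
    intro T
    induction T using Finset.strongInduction with
    | H T ih =>
      choose! C hC0 hC using ih
      have hnn : 0 ≤ ∑ S with i ∈ S ∧ S ⊂ T, pM S T * C S := by
        refine Finset.sum_nonneg fun S hS => mul_nonneg (hM S T) (hC0 S ?_)
        simp only [Finset.mem_filter, Finset.mem_univ, true_and] at hS
        exact hS.2
      refine ⟨(∑ S with i ∈ S ∧ S ⊂ T, pM S T * C S + 1) / pD T,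
        div_nonneg (by linarith) (hD T).le, fun y η hη hy hi => ?_⟩
      rw [div_mul_eq_mul_div, le_div_iff₀ (hD T), mul_comm, add_mul, Finset.sum_mul, one_mul]
      refine (hy T hi).trans (add_le_add_left (Finset.sum_le_sum fun S hS => ?_) η)
      simp only [Finset.mem_filter, Finset.mem_univ, true_and] at hS
      rw [mul_assoc]
      exact mul_le_mul_of_nonneg_left (hC S hS.2 y η hη hy hS.1) (hM S T)
  choose C hC0 hC using H
  refine ⟨∑ T, C T, Finset.sum_nonneg fun T _ => hC0 T, fun y η hη hy T hT => ?_⟩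
  refine (hC T y η hη hy hT).trans (mul_le_mul_of_nonneg_right ?_ hη)
  exact Finset.single_le_sum (fun S _ => hC0 S) (Finset.mem_univ T)

section Typical

variable {N : ℕ} {F : Type*} [Field F] {Ω : Type*} [MeasurableSpace Ω]

/-- Among the slots in which a user `i` is active at a queue `Q_S`, every erasure event occurs about
as often as expected, up to an error of `η` slots. -/
def Typical (P : Measure Ω) (Z : ℕ → Ω → Fin N → Bool) (r : Rule N F) (K : Fin N → ℕ) (η : ℝ)
    (h : List (Fin N → Bool)) : Prop :=
  ∀ i S (E : Set (Fin N → Bool)), |(tally (r.Active K i S) E h : ℝ) -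
    P.real (Z 0 ⁻¹' E) * tally (r.Active K i S) Set.univ h| ≤ η

variable {P : Measure Ω} {Z : ℕ → Ω → Fin N → Bool}

/-- For typical feedback, the time for which user `i` is active at `Q_S` is at most about
`fhat^i_S K_i`, with approximate equality when all indices of user `i` are zero. -/
theorem exists_activity_bound [IsProbabilityMeasure P] (hZ : Measurable (Z 0))
    (hε : ∀ i, eps P Z {i} < 1) : ∃ C : ℝ, 0 ≤ C ∧
      ∀ (r : Rule N F) (K : Fin N → ℕ) (η : ℝ) (h : List (Fin N → Bool)), 0 ≤ η →
        Typical P Z r K η h → ∀ i,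
        (∀ S, i ∈ S → tally (r.Active K i S) Set.univ h ≤ fhat (eps P Z) i S * K i + C * η) ∧
        ((∀ S, i ∈ S → (r.run K h).cnt i S = 0) → ∀ S, i ∈ S →
          fhat (eps P Z) i S * K i ≤ tally (r.Active K i S) Set.univ h + C * η) := by
  choose C hC0 hC using fun i => exists_flow_bound i
    (pM := fun S T => P.real (Z 0 ⁻¹' transfers i S T))
    (fun S => real_departs_pos hZ (hε i) S) (fun S T => measureReal_nonneg)
  set m : ℝ := Fintype.card (Finset (Fin N)) + 1 with hm
  have hm0 : 0 ≤ m := by positivity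
  have hle : ∀ i, C i * m ≤ (∑ j, C j) * m := fun i =>
    mul_le_mul_of_nonneg_right (Finset.single_le_sum (fun j _ => hC0 j) (Finset.mem_univ i)) hm0
  refine ⟨(∑ j, C j) * m, mul_nonneg (Finset.sum_nonneg fun j _ => hC0 j) hm0,
    fun r K η h hη ht i => ?_⟩
  set A : Finset (Fin N) → ℝ := fun S => tally (r.Active K i S) Set.univ h with hA
  set f : Finset (Fin N) → ℝ := fun S => fhat (eps P Z) i S * K i with hf
  set pD : Finset (Fin N) → ℝ := fun S => P.real (Z 0 ⁻¹' departs i S) with hpD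
  set pM : Finset (Fin N) → Finset (Fin N) → ℝ :=
    fun S T => P.real (Z 0 ⁻¹' transfers i S T) with hpM
  -- The deviation `A - f` solves the homogeneous flow equations, up to the remaining index and an
  -- error that stems from one departure and at most `2 ^ N` transfers.
  have key : ∀ T, i ∈ T → |pD T * (A T - f T) + (r.run K h).cnt i T -
      ∑ S with i ∈ S ∧ S ⊂ T, pM S T * (A S - f S)| ≤ m * η := by
    intro T hT
    have h1 : ((r.run K h).cnt i T : ℝ) + tally (r.Active K i T) (departs i T) h =
        (if T = {i} then (K i : ℝ) else 0) +
          ∑ S with i ∈ S ∧ S ⊂ T, (tally (r.Active K i S) (transfers i S T) h : ℝ) := by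
      exact_mod_cast r.cnt_balance h hT
    have h2 : pD T * f T = (if T = {i} then (K i : ℝ) else 0) +
        ∑ S with i ∈ S ∧ S ⊂ T, pM S T * f S := by
      have := congrArg (· * (K i : ℝ)) (fhat_balance hZ (hε i) hT)
      simp only [add_mul, Finset.sum_mul, ite_mul, one_mul, zero_mul, mul_assoc] at this
      exact this
    have h3 : |∑ S with i ∈ S ∧ S ⊂ T,
        ((tally (r.Active K i S) (transfers i S T) h : ℝ) - pM S T * A S)| ≤
        (m - 1) * η := by
      refine (Finset.abs_sum_le_sum_abs _ _).trans
        ((Finset.sum_le_card_nsmul _ _ η fun S _ => ht i S _).trans ?_)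
      rw [nsmul_eq_mul, hm, add_sub_cancel_right]
      refine mul_le_mul_of_nonneg_right ?_ hη
      exact_mod_cast Finset.card_le_univ _
    have h4 := ht i T (departs i T)
    have h5 : pD T * (A T - f T) + (r.run K h).cnt i T -
        ∑ S with i ∈ S ∧ S ⊂ T, pM S T * (A S - f S) =
        ∑ S with i ∈ S ∧ S ⊂ T,
          ((tally (r.Active K i S) (transfers i S T) h : ℝ) - pM S T * A S) -
        (tally (r.Active K i T) (departs i T) h - pD T * A T) := by
      simp only [mul_sub, Finset.sum_sub_distrib]
      linarith
    rw [h5]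
    refine (abs_sub _ _).trans ?_
    have h6 : m * η = (m - 1) * η + η := by ring
    rw [h6]
    exact add_le_add h3 h4
  refine ⟨fun S hS => ?_, fun h0 S hS => ?_⟩
  · have := hC i (fun S => A S - f S) (m * η) (mul_nonneg hm0 hη) (fun T hT => ?_) S hS
    · have h7 := mul_le_mul_of_nonneg_right (hle i) hη
      simp only [hA, hf] at this
      linarith
    · have h8 := (abs_le.1 (key T hT)).2
      have h9 : (0 : ℝ) ≤ (r.run K h).cnt i T := Nat.cast_nonneg _
      linarith
  · have := hC i (fun S => f S - A S) (m * η) (mul_nonneg hm0 hη) (fun T hT => ?_) S hS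
    · have h7 := mul_le_mul_of_nonneg_right (hle i) hη
      simp only [hA, hf] at this
      linarith
    · have h8 := (abs_le.1 (key T hT)).1
      rw [h0 T hT, Nat.cast_zero, add_zero] at h8
      have h9 : ∑ S with i ∈ S ∧ S ⊂ T, pM S T * (f S - A S) =
          -∑ S with i ∈ S ∧ S ⊂ T, pM S T * (A S - f S) := by
        rw [← Finset.sum_neg_distrib]
        exact Finset.sum_congr rfl fun S _ => by ring
      rw [h9]
      linarith

/-- The left hand side of the inequality which defines `region`. -/
noncomputable def load (ε : Finset (Fin N) → ℝ) (R : Fin N → ℝ) : ℝ :=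
  ∑ S : {S : Finset (Fin N) // S.Nonempty}, S.1.sup' S.2 fun i => fhat ε i S.1 * R i

/-- For typical feedback, the algorithm runs for about `load K` slots: it is not finished before,
and it is finished after that time. -/
theorem exists_load_bound [IsProbabilityMeasure P] (hZ : Measurable (Z 0))
    (hε : ∀ i, eps P Z {i} < 1) : ∃ C : ℝ, 0 ≤ C ∧
      ∀ (r : Rule N F) (K : Fin N → ℕ), r.Admissible K → ∀ (η : ℝ) (h : List (Fin N → Bool)),
        0 ≤ η → Typical P Z r K η h →
        ((r.run K h).current r.order ≠ none →
          (h.length : ℝ) ≤ load (eps P Z) (fun i => K i) + C * η) ∧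
        ((r.run K h).current r.order = none →
          load (eps P Z) (fun i => K i) ≤ h.length + C * η) := by
  obtain ⟨C, hC0, hC⟩ := exists_activity_bound (F := F) hZ hε
  refine ⟨Fintype.card {S : Finset (Fin N) // S.Nonempty} * C, by positivity,
    fun r K hr η h hη ht => ⟨fun hc => ?_, fun hc => ?_⟩⟩
  · rw [← r.sum_tally_serves_eq hc, Nat.cast_sum, load, mul_assoc, ← nsmul_eq_mul,
      ← Finset.card_univ, ← Finset.sum_const, ← Finset.sum_add_distrib]
    refine Finset.sum_le_sum fun S _ => ?_
    obtain ⟨i, hi, hA⟩ := hr.exists_tally_active_eq S.2 h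
    rw [← hA]
    refine ((hC r K η h hη ht i).1 S.1 hi).trans (add_le_add_left ?_ _)
    exact Finset.le_sup' (fun i => fhat (eps P Z) i S.1 * (K i : ℝ)) hi
  · have h1 : (∑ S : {S : Finset (Fin N) // S.Nonempty},
        (tally (r.Serves K S.1) Set.univ h : ℝ)) ≤ h.length := by
      exact_mod_cast r.sum_tally_serves_le h
    refine le_trans ?_ (add_le_add_left h1 _)
    rw [load, mul_assoc, ← nsmul_eq_mul, ← Finset.card_univ, ← Finset.sum_const,
      ← Finset.sum_add_distrib]
    refine Finset.sum_le_sum fun S _ => Finset.sup'_le _ _ fun i hi => ?_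
    refine ((hC r K η h hη ht i).2
      (fun T hT => State.cnt_eq_zero_of_current_eq_none hr.mem_order hc hT) S.1 hi).trans
      (add_le_add_left ?_ _)
    have h2 : tally (r.Active K i S.1) Set.univ h ≤ tally (r.Serves K S.1) Set.univ h :=
      tally_mono (fun _ h => h.1) _ h
    exact_mod_cast h2

end Typical

/-! ### The feedback is typical with high probability -/

section Probability

variable {N : ℕ} {Ω : Type*} [MeasurableSpace Ω] {P : Measure Ω} {Z : ℕ → Ω → Fin N → Bool}

theorem length_feedback (z : ℕ → Fin N → Bool) (n : ℕ) : (feedback z n).length = n := by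
  induction n with
  | zero => rfl
  | succ n ih => rw [feedback, List.length_cons, ih]

theorem feedback_congr {z z' : ℕ → Fin N → Bool} {n : ℕ} (h : ∀ l < n, z l = z' l) :
    feedback z n = feedback z' n := by
  induction n with
  | zero => rfl
  | succ n ih => rw [feedback, feedback, h n n.lt_succ_self, ih fun l hl => h l (by omega)]

/-- The feedback of the first `n` slots as a function of finitely many variables. -/
theorem exists_feedback_eq (n : ℕ) :
    ∃ φ : (Finset.range n → Fin N → Bool) → List (Fin N → Bool),
      ∀ z : ℕ → Fin N → Bool, feedback z n = φ fun l => z l := by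
  refine ⟨fun g => feedback (fun l => if h : l ∈ Finset.range n then g ⟨l, h⟩ else default) n,
    fun z => feedback_congr fun l hl => ?_⟩
  rw [dif_pos (Finset.mem_range.2 hl)]

theorem integrable_feedback [IsFiniteMeasure P] (hZ : ∀ l, Measurable (Z l)) (n : ℕ)
    (ψ : List (Fin N → Bool) → ℝ) :
    Integrable (fun ω => ψ (feedback (fun l => Z l ω) n)) P := by
  obtain ⟨φ, hφ⟩ := exists_feedback_eq (N := N) n
  simp only [hφ]
  have hm : Measurable fun ω => fun l : Finset.range n => Z l ω :=
    measurable_pi_lambda _ fun l => hZ l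
  exact (Integrable.of_finite (f := fun g => ψ (φ g)) (μ := P.map _)).comp_measurable hm

/-- A function of the previous slots is uncorrelated with a centred function of the present one. -/
theorem integral_feedback_mul (hZ : ∀ l, Measurable (Z l)) (hindep : iIndepFun Z P) (n : ℕ)
    (ψ : List (Fin N → Bool) → ℝ) (ξ : (Fin N → Bool) → ℝ) (hξ : ∫ ω, ξ (Z n ω) ∂P = 0) :
    ∫ ω, ψ (feedback (fun l => Z l ω) n) * ξ (Z n ω) ∂P = 0 := by
  obtain ⟨φ, hφ⟩ := exists_feedback_eq (N := N) n
  simp only [hφ]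
  have hm : Measurable fun ω => fun l : Finset.range n => Z l ω :=
    measurable_pi_lambda _ fun l => hZ l
  have hi := hindep.indepFun_finset (Finset.range n) {n} (by simp) hZ
  have hi' : IndepFun (fun ω => ψ (φ fun l : Finset.range n => Z l ω)) (fun ω => ξ (Z n ω)) P :=
    hi.comp (φ := fun g => ψ (φ g))
      (ψ := fun g : ({n} : Finset ℕ) → Fin N → Bool => ξ (g ⟨n, Finset.mem_singleton_self n⟩))
      Measurable.of_discrete Measurable.of_discrete
  rw [hi'.integral_fun_mul_eq_mul_integral
    ((Measurable.of_discrete (f := fun g => ψ (φ g))).comp hm).aestronglyMeasurable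
    ((Measurable.of_discrete (f := ξ)).comp (hZ n)).aestronglyMeasurable, hξ, mul_zero]

/-- The deviation of a tally from its compensator is a martingale with increments bounded by `1`, so
its second moment grows at most linearly. -/
theorem integral_tally_sub_sq_le [IsProbabilityMeasure P] (hZ : ∀ l, Measurable (Z l))
    (hindep : iIndepFun Z P) (hident : ∀ l, IdentDistrib (Z l) (Z 0) P P)
    (q : List (Fin N → Bool) → Prop) (E : Set (Fin N → Bool)) (n : ℕ) :
    ∫ ω, ((tally q E (feedback (fun l => Z l ω) n) : ℝ) -
      P.real (Z 0 ⁻¹' E) * tally q Set.univ (feedback (fun l => Z l ω) n)) ^ 2 ∂P ≤ n := by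
  classical
  set p := P.real (Z 0 ⁻¹' E) with hp
  set X : List (Fin N → Bool) → ℝ := fun h => tally q E h - p * tally q Set.univ h with hX
  set ξ : (Fin N → Bool) → ℝ := fun z => E.indicator 1 z - p with hξ
  set H : List (Fin N → Bool) → ℝ := fun h => if q h then 1 else 0 with hH
  have hstep : ∀ z h, X (z :: h) = X h + H h * ξ z := by
    intro z h
    by_cases hq : q h <;> by_cases hz : z ∈ E <;> simp [hX, tally, hH, hξ, hq, hz] <;> ring
  have hp01 : 0 ≤ p ∧ p ≤ 1 := ⟨measureReal_nonneg, measureReal_le_one⟩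
  have hsq : ∀ z h, (H h * ξ z) ^ 2 ≤ 1 := by
    intro z h
    by_cases hq : q h <;> by_cases hz : z ∈ E <;> simp [hH, hξ, hq, hz, abs_le] <;>
      constructor <;> linarith
  have hmean : ∀ l, ∫ ω, ξ (Z l ω) ∂P = 0 := by
    intro l
    have hE : MeasurableSet (Z l ⁻¹' E) := hZ l MeasurableSet.of_discrete
    have h1 : ∀ ω, ξ (Z l ω) = (Z l ⁻¹' E).indicator 1 ω - p := fun ω => rfl
    simp only [h1]
    have h2 : Integrable (fun ω => (Z l ⁻¹' E).indicator (1 : Ω → ℝ) ω) P :=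
      (integrable_const (1 : ℝ)).indicator hE
    rw [integral_sub h2 (integrable_const p),
      integral_indicator_one hE, integral_const, probReal_univ, one_smul, hp, measureReal_def,
      measureReal_def, (hident l).measure_mem_eq MeasurableSet.of_discrete, sub_self]
  change ∫ ω, X (feedback (fun l => Z l ω) n) ^ 2 ∂P ≤ n
  induction n with
  | zero => simp [feedback, hX, tally]
  | succ n ih =>
    simp only [feedback, hstep]
    have e : ∀ ω,
        (X (feedback (fun l => Z l ω) n) + H (feedback (fun l => Z l ω) n) * ξ (Z n ω)) ^ 2 =
          X (feedback (fun l => Z l ω) n) ^ 2 +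
          (2 * X (feedback (fun l => Z l ω) n) * H (feedback (fun l => Z l ω) n)) * ξ (Z n ω) +
          (H (feedback (fun l => Z l ω) n) * ξ (Z n ω)) ^ 2 := fun ω => by ring
    simp only [e]
    have i1 := integrable_feedback (P := P) hZ n fun h => X h ^ 2
    have i2 := integrable_feedback (P := P) hZ (n + 1)
      fun h => (2 * X h.tail * H h.tail) * ξ (h.headD default)
    have i3 := integrable_feedback (P := P) hZ (n + 1)
      fun h => (H h.tail * ξ (h.headD default)) ^ 2
    simp only [feedback, List.tail_cons, List.headD_cons] at i2 i3
    have i12 : Integrable (fun ω => X (feedback (fun l => Z l ω) n) ^ 2 +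
        (2 * X (feedback (fun l => Z l ω) n) * H (feedback (fun l => Z l ω) n)) * ξ (Z n ω)) P :=
      i1.add i2
    rw [integral_add i12 i3, integral_add i1 i2,
      integral_feedback_mul hZ hindep n (fun h => 2 * X h * H h) ξ (hmean n), add_zero]
    have h3 : ∫ ω, (H (feedback (fun l => Z l ω) n) * ξ (Z n ω)) ^ 2 ∂P ≤ 1 := by
      have := integral_mono i3 (integrable_const 1) fun ω => hsq (Z n ω) _
      simpa using this
    push_cast
    linarith

variable {F : Type*} [Field F]

/-- By Chebyshev's inequality, the feedback is typical with high probability, uniformly over all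
rules and all numbers of packets. -/
theorem real_not_typical_le [IsProbabilityMeasure P] (hZ : ∀ l, Measurable (Z l))
    (hindep : iIndepFun Z P) (hident : ∀ l, IdentDistrib (Z l) (Z 0) P P) (r : Rule N F)
    (K : Fin N → ℕ) {δ : ℝ} (hδ : 0 < δ) {n : ℕ} (hn : 0 < n) :
    P.real {ω | ¬Typical P Z r K (δ * n) (feedback (fun l => Z l ω) n)} ≤
      Nat.card (Fin N × Finset (Fin N) × Set (Fin N → Bool)) / (δ ^ 2 * n) := by
  classical
  have hn' : (0 : ℝ) < n := by exact_mod_cast hn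
  set X : Fin N × Finset (Fin N) × Set (Fin N → Bool) → Ω → ℝ := fun x ω =>
    (tally (r.Active K x.1 x.2.1) x.2.2 (feedback (fun l => Z l ω) n) : ℝ) -
      P.real (Z 0 ⁻¹' x.2.2) * tally (r.Active K x.1 x.2.1) Set.univ (feedback (fun l => Z l ω) n)
    with hX
  have hsub : {ω | ¬Typical P Z r K (δ * n) (feedback (fun l => Z l ω) n)} ⊆
      ⋃ x, {ω | (δ * n) ^ 2 ≤ X x ω ^ 2} := by
    intro ω hω
    simp only [Typical, Set.mem_ofPred_eq, not_forall, not_le] at hω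
    obtain ⟨i, S, E, h⟩ := hω
    refine Set.mem_iUnion.2 ⟨(i, S, E), ?_⟩
    rw [Set.mem_ofPred_eq, ← sq_abs (X _ _)]
    exact pow_le_pow_left₀ (by positivity) h.le 2
  have hone : ∀ x, P.real {ω | (δ * n) ^ 2 ≤ X x ω ^ 2} ≤ 1 / (δ ^ 2 * n) := by
    intro x
    have h1 := mul_meas_ge_le_integral_of_nonneg (μ := P) (f := fun ω => X x ω ^ 2)
      (Eventually.of_forall fun ω => sq_nonneg _)
      (integrable_feedback hZ n fun h => ((tally (r.Active K x.1 x.2.1) x.2.2 h : ℝ) -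
        P.real (Z 0 ⁻¹' x.2.2) * tally (r.Active K x.1 x.2.1) Set.univ h) ^ 2) ((δ * n) ^ 2)
    have h2 := h1.trans (integral_tally_sub_sq_le hZ hindep hident (r.Active K x.1 x.2.1) x.2.2 n)
    rw [le_div_iff₀ (by positivity)]
    have h3 : (δ * n) ^ 2 * P.real {ω | (δ * n) ^ 2 ≤ X x ω ^ 2} =
        n * (P.real {ω | (δ * n) ^ 2 ≤ X x ω ^ 2} * (δ ^ 2 * n)) := by ring
    rw [h3] at h2
    exact le_of_mul_le_mul_left (by linarith) hn'
  refine (measureReal_mono hsub).trans ((measureReal_iUnion_fintype_le _).trans ?_)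
  refine (Finset.sum_le_card_nsmul _ _ _ fun x _ => hone x).trans (le_of_eq ?_)
  rw [nsmul_eq_mul, Finset.card_univ, Nat.card_eq_fintype_card, mul_one_div]

end Probability

/-! ### The rate region -/

section Load

variable {N : ℕ}

theorem load_smul (ε : Finset (Fin N) → ℝ) {t : ℝ} (ht : 0 ≤ t) (R : Fin N → ℝ) :
    load ε (t • R) = t * load ε R := by
  rw [load, load, Finset.mul_sum]
  refine Finset.sum_congr rfl fun S _ => ?_
  rw [Finset.mul₀_sup' ht]
  refine Finset.sup'_congr _ rfl fun i _ => ?_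
  rw [Pi.smul_apply, smul_eq_mul]
  ring

/-- Rounding the arguments changes the load by a bounded amount only. -/
theorem load_le_add (ε : Finset (Fin N) → ℝ) {R R' : Fin N → ℝ} (h : ∀ i, |R i - R' i| ≤ 1) :
    load ε R ≤ load ε R' +
      ∑ S : {S : Finset (Fin N) // S.Nonempty}, ∑ i, |fhat ε i S.1| := by
  rw [load, load, ← Finset.sum_add_distrib]
  refine Finset.sum_le_sum fun S _ => Finset.sup'_le _ _ fun i hi => ?_
  have h1 := Finset.le_sup' (fun i => fhat ε i S.1 * R' i) hi
  have h2 := Finset.single_le_sum (f := fun i => |fhat ε i S.1|) (fun j _ => abs_nonneg _)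
    (Finset.mem_univ i)
  have h3 : fhat ε i S.1 * (R i - R' i) ≤ |fhat ε i S.1| := by
    refine (le_abs_self _).trans ?_
    rw [abs_mul]
    exact mul_le_of_le_one_right (abs_nonneg _) (h i)
  linarith

theorem continuous_load (ε : Finset (Fin N) → ℝ) : Continuous (load ε) := by
  refine continuous_finsetSum _ fun S _ => ?_
  exact Continuous.finset_sup'_apply _ fun i _ => continuous_const.mul (continuous_apply i)

theorem isClosed_region (ε : Finset (Fin N) → ℝ) (L : ℕ) : IsClosed (region ε L) :=
  (isClosed_le continuous_const continuous_id).inter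
    (isClosed_le (continuous_load ε) continuous_const)

theorem region_subset_closure (ε : Finset (Fin N) → ℝ) {L : ℕ} (hL : 0 < L) :
    region ε L ⊆ closure {R | 0 ≤ R ∧ load ε R < L} := by
  rintro R ⟨hR, hload⟩
  have hL' : (0 : ℝ) < L := by exact_mod_cast hL
  have hlim : Tendsto (fun t : ℝ => t • R) (𝓝[<] 1) (𝓝 R) := by
    have : Tendsto (fun t : ℝ => t • R) (𝓝 1) (𝓝 ((1 : ℝ) • R)) :=
      (continuous_id.smul continuous_const).tendsto 1
    rw [one_smul] at this
    exact this.mono_left nhdsWithin_le_nhds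
  refine mem_closure_of_tendsto hlim ?_
  filter_upwards [Ioo_mem_nhdsLT (zero_lt_one (α := ℝ))] with t ht
  refine ⟨smul_nonneg ht.1.le hR, ?_⟩
  rw [load_smul ε ht.1.le]
  calc t * load ε R ≤ t * L := mul_le_mul_of_nonneg_left hload ht.1.le
    _ < 1 * L := mul_lt_mul_of_pos_right ht.2 hL'
    _ = L := one_mul _

end Load

section Region

variable {N L : ℕ} {F : Type*} [Field F] {Ω : Type*} [MeasurableSpace Ω] {P : Measure Ω}
  {Z : ℕ → Ω → Fin N → Bool}

/-- For sessions of rates `R` with `load R ≠ L` and large blocklengths, typical feedback lets the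
algorithm terminate in time iff `load R < L`. -/
theorem eventually_terminates_iff [IsProbabilityMeasure P] (hL : 0 < L) (hZ : Measurable (Z 0))
    (hε : ∀ i, eps P Z {i} < 1) {R : Fin N → ℝ} (hR : 0 ≤ R) (hload : load (eps P Z) R ≠ L) :
    ∃ δ : ℝ, 0 < δ ∧ ∀ᶠ n : ℕ in atTop, ∀ (r : Rule N F) (K : Fin N → ℕ), r.Admissible K →
      (∀ i, K i = ⌈(n : ℝ) * R i / L⌉₊) → ∀ h : List (Fin N → Bool), h.length = n →
      Typical P Z r K (δ * n) h →
        ((r.run K h).current r.order = none ↔ load (eps P Z) R < L) := by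
  obtain ⟨C, hC0, hC⟩ := exists_load_bound (F := F) hZ hε
  have hL' : (0 : ℝ) < L := by exact_mod_cast hL
  set ρ := load (eps P Z) R / L with hρ
  set c := ∑ S : {S : Finset (Fin N) // S.Nonempty}, ∑ i, |fhat (eps P Z) i S.1|
  have hgap : 0 < |1 - ρ| := by
    rw [abs_pos, sub_ne_zero, hρ, ne_comm, ne_eq, div_eq_one_iff_eq hL'.ne']
    exact hload
  have hlt : load (eps P Z) R < L ↔ ρ < 1 := by rw [hρ, div_lt_one hL']
  -- This `δ` makes the random error `C * δ * n` at most half of the gap `|1 - ρ| * n`; for large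
  -- `n`, the rounding error `c` is smaller than the other half.
  refine ⟨|1 - ρ| / (2 * (C + 1)), by positivity, ?_⟩
  filter_upwards [(tendsto_natCast_atTop_atTop (R := ℝ)).eventually_gt_atTop (2 * c / |1 - ρ|)]
    with n hn r K hr hK h hlen ht
  rw [div_lt_iff₀ hgap] at hn
  have hload_smul : load (eps P Z) (((n : ℝ) / L) • R) = n * ρ := by
    rw [load_smul _ (by positivity), hρ]
    ring
  have hceil : ∀ i, |(K i : ℝ) - (((n : ℝ) / L) • R) i| ≤ 1 := by
    intro i
    have h0 : (0 : ℝ) ≤ n * R i / L := div_nonneg (mul_nonneg n.cast_nonneg (hR i)) hL'.le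
    have h1 := Nat.le_ceil ((n : ℝ) * R i / L)
    have h2 := Nat.ceil_lt_add_one h0
    have h3 : (((n : ℝ) / L) • R) i = n * R i / L := by
      rw [Pi.smul_apply, smul_eq_mul]
      ring
    rw [hK i, h3, abs_le]
    constructor <;> linarith
  have hup : load (eps P Z) (fun i => K i) ≤ n * ρ + c := by
    rw [← hload_smul]
    exact load_le_add (eps P Z) hceil
  have hlo : n * ρ ≤ load (eps P Z) (fun i => K i) + c := by
    rw [← hload_smul]
    exact load_le_add (eps P Z) fun i => by rw [abs_sub_comm]; exact hceil i
  have hη : C * (|1 - ρ| / (2 * (C + 1)) * n) ≤ |1 - ρ| * n / 2 := by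
    have : C / (C + 1) ≤ 1 := (div_le_one (by positivity)).2 (by linarith)
    calc C * (|1 - ρ| / (2 * (C + 1)) * n) = C / (C + 1) * (|1 - ρ| * n / 2) := by
          field_simp
      _ ≤ |1 - ρ| * n / 2 := mul_le_of_le_one_left (by positivity) this
  obtain ⟨h1, h2⟩ := hC r K hr _ h (by positivity) ht
  rw [hlen] at h1 h2
  rw [hlt]
  constructor
  · intro hc
    have h3 : n * ρ ≤ n + |1 - ρ| * n / 2 + c := by linarith [h2 hc]
    by_contra hge
    rw [abs_of_nonpos (by linarith)] at h3 hn
    linarith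
  · intro hlt
    by_contra hc
    have h3 : n ≤ n * ρ + c + |1 - ρ| * n / 2 := by linarith [h1 hc]
    rw [abs_of_pos (by linarith)] at h3 hn
    linarith

theorem tendsto_const_div_mul_natCast (D δ : ℝ) (hδ : 0 < δ) :
    Tendsto (fun n : ℕ => D / (δ ^ 2 * n)) atTop (𝓝 0) :=
  tendsto_const_nhds.div_atTop
    (tendsto_natCast_atTop_atTop.const_mul_atTop (by positivity))

variable [Fintype F]

/-- Below the threshold, an error requires atypical feedback, whatever the codes. -/
theorem achievableUnder_of_load_lt [IsProbabilityMeasure P] (hL : 0 < L)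
    (hZ : ∀ l, Measurable (Z l)) (hindep : iIndepFun Z P)
    (hident : ∀ l, IdentDistrib (Z l) (Z 0) P P) (hε : ∀ i, eps P Z {i} < 1)
    {C : Set (Code N F)} (hC : C ⊆ CODE1pub N F)
    (hCall : ∀ (K : Fin N → ℕ) (n : ℕ), ∃ c ∈ C, c.packets = K ∧ c.len = n)
    {R : Fin N → ℝ} (hR : 0 ≤ R) (hload : load (eps P Z) R < L) :
    AchievableUnder P Z L C R := by
  refine ⟨hR, ?_⟩
  choose c hcC hcK hcn using fun n : ℕ => hCall (fun i => ⌈(n : ℝ) * R i / L⌉₊) n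
  refine ⟨c, fun n => ⟨hcC n, hcn n, fun i => by rw [hcK n]⟩, ?_⟩
  obtain ⟨δ, hδ, hev⟩ := eventually_terminates_iff (F := F) hL (hZ 0) hε hR hload.ne
  refine squeeze_zero' (Eventually.of_forall fun n => ?_) ?_
    (tendsto_const_div_mul_natCast
      (Nat.card (Fin N × Finset (Fin N) × Set (Fin N → Bool))) δ hδ)
  · exact div_nonneg (Finset.sum_nonneg fun w _ => measureReal_nonneg) (Nat.cast_nonneg _)
  · filter_upwards [hev, eventually_gt_atTop 0] with n hn hpos
    obtain ⟨K, n', r, hr, hc⟩ := hC (hcC n)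
    have hK := hcK n
    have hn' := hcn n
    rw [hc] at hK hn' ⊢
    change K = _ at hK
    change n' = n at hn'
    subst hn'
    rw [hr.avgError_eq]
    refine le_trans (measureReal_mono ?_) (real_not_typical_le hZ hindep hident r K hδ hpos)
    intro ω hω ht
    exact hω ((hn r K hr (fun i => by rw [hK]) _ (length_feedback _ _) ht).2 hload)

/-- Above the threshold, the algorithm terminates in time only if the feedback is atypical, so the
error probability tends to one. -/
theorem load_le_of_achievableUnder [IsProbabilityMeasure P] (hL : 0 < L)
    (hZ : ∀ l, Measurable (Z l)) (hindep : iIndepFun Z P)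
    (hident : ∀ l, IdentDistrib (Z l) (Z 0) P P) (hε : ∀ i, eps P Z {i} < 1)
    {C : Set (Code N F)} (hC : C ⊆ CODE1pub N F) {R : Fin N → ℝ}
    (h : AchievableUnder P Z L C R) : load (eps P Z) R ≤ L := by
  obtain ⟨hR, c, hc, hlim⟩ := h
  by_contra! hload
  obtain ⟨δ, hδ, hev⟩ := eventually_terminates_iff (F := F) hL (hZ 0) hε hR hload.ne'
  have hlim' := hlim.add (tendsto_const_div_mul_natCast
      (Nat.card (Fin N × Finset (Fin N) × Set (Fin N → Bool))) δ hδ)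
  have : (1 : ℝ) ≤ 0 + 0 := by
    refine ge_of_tendsto hlim' ?_
    filter_upwards [hev, eventually_gt_atTop 0] with n hn hpos
    obtain ⟨hcC, hn', hK⟩ := hc n
    obtain ⟨K, n', r, hr, hcr⟩ := hC hcC
    rw [hcr] at hK hn' ⊢
    change ∀ i, K i = _ at hK
    change n' = n at hn'
    subst hn'
    rw [hr.avgError_eq]
    refine le_trans ?_ (add_le_add_right (real_not_typical_le hZ hindep hident r K hδ hpos) _)
    refine le_trans (le_of_eq ?_) (measureReal_union_le _ _)
    rw [← probReal_univ (μ := P)]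
    congr 1
    symm
    rw [Set.eq_univ_iff_forall]
    intro ω
    by_cases ht : Typical P Z r K (δ * n') (feedback (fun l => Z l ω) n')
    · left
      intro h0
      exact absurd ((hn r K hr hK _ (length_feedback _ _) ht).1 h0) (not_lt.2 hload.le)
    · exact Or.inr ht
  norm_num at this

theorem rateRegion_eq_region [IsProbabilityMeasure P] (hL : 0 < L)
    (hZ : ∀ l, Measurable (Z l)) (hindep : iIndepFun Z P)
    (hident : ∀ l, IdentDistrib (Z l) (Z 0) P P) (hε : ∀ i, eps P Z {i} < 1)
    {C : Set (Code N F)} (hC : C ⊆ CODE1pub N F)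
    (hCall : ∀ (K : Fin N → ℕ) (n : ℕ), ∃ c ∈ C, c.packets = K ∧ c.len = n) :
    rateRegion P Z L C = region (eps P Z) L := by
  refine Set.Subset.antisymm ?_ ?_
  · refine closure_minimal (fun R hR => ⟨hR.1, ?_⟩) (isClosed_region _ _)
    exact load_le_of_achievableUnder hL hZ hindep hident hε hC hR
  · refine (region_subset_closure _ hL).trans (closure_mono fun R hR => ?_)
    exact achievableUnder_of_load_lt hL hZ hindep hident hε hC hCall hR.1 hR.2

end Region

end ErasureBC

theorem mainTheorem1 (N L : ℕ) (hL : N < 2 ^ L)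
    {F : Type*} [Field F] [Fintype F] (hF : Fintype.card F = 2 ^ L)
    {Ω : Type*} [MeasurableSpace Ω] (P : Measure Ω) [IsProbabilityMeasure P]
    (Z : ℕ → Ω → Fin N → Bool) (hZ : ∀ l, Measurable (Z l)) (hindep : iIndepFun Z P)
    (hident : ∀ l, IdentDistrib (Z l) (Z 0) P P)
    (hε : ∀ i, ErasureBC.eps P Z {i} < 1) :
    ErasureBC.rateRegion P Z L (ErasureBC.CODE1pub N F) =
        ErasureBC.region (ErasureBC.eps P Z) L ∧
      ∀ C : Set (ErasureBC.Code N F), C ⊆ ErasureBC.CODE1pub N F →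
        (∀ (K : Fin N → ℕ) (n : ℕ), ∃ c ∈ C, c.packets = K ∧ c.len = n) →
        ErasureBC.rateRegion P Z L C = ErasureBC.region (ErasureBC.eps P Z) L := by
  have hL0 : 0 < L := by
    rcases Nat.eq_zero_or_pos L with rfl | h
    · have := Fintype.one_lt_card (α := F)
      rw [hF] at this
      simp at this
    · exact h
  refine ⟨ErasureBC.rateRegion_eq_region hL0 hZ hindep hident hε subset_rfl fun K n => ?_,
    fun C hC hCall => ErasureBC.rateRegion_eq_region hL0 hZ hindep hident hε hC hCall⟩
  obtain ⟨r, hr⟩ := ErasureBC.exists_admissible (F := F) (hF.symm ▸ hL) K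
  exact ⟨r.toCode K n, ⟨K, n, r, hr, rfl⟩, rfl, rfl⟩
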